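/- Let $C$ be a smooth projective geometrically irreducible curve over a finite field $\mathbb{F}_q$ with $\operatorname{char}\mathbb{F}_q\neq 2$. Let $E$ be an effective very ample divisor on $C$ such that $E\geq 3E_0$ for some effective very ample divisor $E_0$ on $C$, and let $R$ be the ring of regular functions on $C\setminus E:=C\setminus\operatorname{supp}(E)$. Let $f_0\in R$ satisfy $-\nu_{\mathfrak p}(f_0)>\nu_{\mathfrak p}(E)$ for all $\mathfrak p\in\operatorname{supp}(E)$, and let $\sigma_1\neq\sigma_2$ be elements of $R$ such that, for $i=1,2$ and all $\mathfrak p\in\operatorname{supp}(E)$, $$\nu_{\mathfrak p}(\sigma_i)\neq\nu_{\mathfrak p}(f_0)\quad\text{and}\quad -\nu_{\mathfrak p}(\sigma_i)>\nu_{\mathfrak p}(E).$$ Let $\{1,g_1,\dots,g_m\}$ be an $\mathbb{F}_q$-basis of $H^0(C,\mathcal{O}(E))$, let $A_0,\dots,A_m$ be independent variables, and put $\mathbb{F}_q(\mathbf A')=\mathbb{F}_q(A_1,\dots,A_m)$ and $\mathbb{F}_q(\mathbf A)=\mathbb{F}_q(A_0,A_1,\dots,A_m)$. For $i=1,2$ let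 $$\Psi_i=\sigma_i+f_0+\sum_{j=1}^m A_j g_j\ \in\ \mathbb{F}_q(\mathbf A')\otimes_{\mathbb{F}_q}R,$$ regarded as a morphism from $(C\setminus E)_{\mathbb{F}_q(\mathbf A')}=\operatorname{Spec}(\mathbb{F}_q(\mathbf A')\otimes_{\mathbb{F}_q}R)$ to the affine line over $\mathbb{F}_q(\mathbf A')$. Then the following hold. 1. There are no (not necessarily distinct) points $x,y$ of the scheme $(C\setminus E)_{\mathbb{F}_q(\mathbf A')}$ such that $d\Psi_1|_x=0$, $d\Psi_2|_y=0$ and $\Psi_1(x)=\Psi_2(y)$. Here $d\Psi|_x$ denotes the image of $d\Psi$ in the fibre at $x$ of the sheaf of Kähler differentials over $\mathbb{F}_q(\mathbf A')$, and $\Psi_1(x)$, $\Psi_2(y)$ are points of the affine line. 2. Equivalently, the branch loci of $\Psi_1$ and $\Psi_2$ in the affine line over $\mathbb{F}_q(\mathbf A')$ are disjoint, where the branch locus of $\Psi_i$ is the set of all $\Psi_i(x)$ with $x\in(C\setminus E)_{\mathbb{F}_q(\mathbf A')}$ and $d\Psi_i|_x=0$. 3. The discriminants $D_1$ and $D_2$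 are coprime in the polynomial ring $\mathbb{F}_q(\mathbf A')[A_0]$. Here $D_i$ is any generator of the discriminant ideal, over $\mathbb{F}_q(\mathbf A')[A_0]$, of the splitting field over $\mathbb{F}_q(\mathbf A)$ of $\Psi_i+A_0$. This splitting field is the composite, inside an algebraic closure of $\mathbb{F}_q(\mathbf A)$, of the normal closures of the residue fields at the primes of $\mathbb{F}_q(\mathbf A)\otimes_{\mathbb{F}_q}R$ containing $\Psi_i+A_0$. The discriminant ideal of a finite extension $L/\mathbb{F}_q(\mathbf A)$ is generated by the discriminants of all bases of $L$ consisting of elements integral over $\mathbb{F}_q(\mathbf A')[A_0]$. -/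

import Mathlib

open AlgebraicGeometry CategoryTheory TensorProduct

noncomputable section

namespace ShortInterval

universe u

/-- A smooth projective geometrically irreducible curve over a field `k`. A scheme that is smooth
over a field is geometrically reduced, so that "geometrically irreducible" and "geometrically
integral" mean the same here; smooth proper curves over a field are projective. -/
structure Curve (k : Type u) [Field k] where
  /-- the underlying scheme -/
  scheme : Scheme.{u}
  /-- the structure morphism -/
  hom : scheme ⟶ Spec (.of k)
  proper : IsProper hom
  smooth : SmoothOfRelativeDimension 1 hom
  geometricallyIntegral : GeometricallyIntegral hom

namespace Curve

variable {k : Type u} [Field k] (C : Curve k)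

instance : IsProper C.hom := C.proper
instance : SmoothOfRelativeDimension 1 C.hom := C.smooth
instance : GeometricallyIntegral C.hom := C.geometricallyIntegral

instance : IsIntegral C.scheme :=
  GeometricallyIntegral.isIntegral_of_subsingleton C.hom

instance : IsLocallyNoetherian C.scheme :=
  LocallyOfFiniteType.isLocallyNoetherian C.hom

/-- The closed points of the curve, i.e. its points of codimension one. -/
abbrev ClosedPoint : Type u := {p : C.scheme // Order.coheight p = 1}

/-- Divisors on the curve, as finite formal sums of closed points. A divisor `E` is effective if
`0 ≤ E`, and `E' ≤ E` means that `E - E'` is effective. -/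
abbrev Divisor : Type u := C.ClosedPoint →₀ ℤ

/-- The field of rational functions on the curve. -/
abbrev FunctionField : Type u := C.scheme.functionField

/-- The valuation `ν_p` at a closed point `p`, on nonzero rational functions. -/
def ν (p : C.ClosedPoint) (h : C.FunctionField) : ℤ := Scheme.ord h p.1

/-- The open complement of the support of a divisor. -/
def compl (E : C.Divisor) : C.scheme.Opens :=
  ⟨(closure (Subtype.val '' (E.support : Set C.ClosedPoint)))ᶜ, isClosed_closure.isOpen_compl⟩

lemma genericPoint_mem_compl (E : C.Divisor) : genericPoint C.scheme ∈ C.compl E := by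
  intro h
  have hfin : (Subtype.val '' (E.support : Set C.ClosedPoint)).Finite :=
    E.support.finite_toSet.image _
  rw [← Set.biUnion_of_singleton (Subtype.val '' (E.support : Set C.ClosedPoint)),
    hfin.closure_biUnion] at h
  simp only [Set.mem_iUnion] at h
  obtain ⟨p, ⟨q, -, rfl⟩, hp⟩ := h
  have h0 : Order.coheight q.1 = 0 := by
    rw [Order.coheight_eq_zero]
    intro y _
    exact (specializes_iff_mem_closure.mpr hp).trans (genericPoint_specializes y)
  have h1 := q.2
  rw [h0] at h1
  exact zero_ne_one h1

instance (E : C.Divisor) : Nonempty (C.compl E) := ⟨⟨_, C.genericPoint_mem_compl E⟩⟩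

/-- The ring `R` of regular functions on the complement of the support of `E`. -/
abbrev RegularFunctions (E : C.Divisor) : Type u := Γ(C.scheme, C.compl E)

/-- The constants `k → Γ(C, U)`. -/
def constants (U : C.scheme.Opens) : k →+* Γ(C.scheme, U) :=
  (C.hom.appLE ⊤ U le_top).hom.comp (Scheme.ΓSpecIso (.of k)).inv.hom

instance (E : C.Divisor) : Algebra k (C.RegularFunctions E) := (C.constants _).toAlgebra

instance : Algebra k C.FunctionField :=
  ((C.scheme.presheaf.germ ⊤ (genericPoint C.scheme) trivial).hom.comp (C.constants ⊤)).toAlgebra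

/-- A regular function on the complement of `E`, viewed as a rational function. -/
abbrev toRational (E : C.Divisor) (f : C.RegularFunctions E) : C.FunctionField :=
  algebraMap (C.RegularFunctions E) C.FunctionField f

/-- The Riemann-Roch space `H⁰(C, 𝒪(E))`: the rational functions `h` that are zero or satisfy
`ν_p(h) ≥ -ν_p(E)` at every closed point `p`. -/
def H0 (E : C.Divisor) : Set C.FunctionField :=
  {h | h = 0 ∨ ∀ p, -E p ≤ C.ν p h}

end Curve

section ProjectiveSpace

attribute [local instance] MvPolynomial.gradedAlgebra

/-- Projective `n`-space over `k`, as `Proj k[X₀, …, Xₙ]`. -/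
abbrev ProjSpace (k : Type u) [Field k] (n : ℕ) : Scheme.{u} :=
  Proj (MvPolynomial.homogeneousSubmodule (Fin (n + 1)) k)

variable {k : Type u} [Field k]

/-- `φ` is the morphism `[s₀ : ⋯ : sₙ]` to projective space given by nonzero rational functions
`s₀, …, sₙ`: for each `i` it maps the generic point of the curve into the standard chart
`X_i ≠ 0`, where it is given by `F / X_i ^ d ↦ F(s₀, …, sₙ) / s_i ^ d` for `F` homogeneous of
degree `d`. -/
def Curve.IsGivenBy (C : Curve k) {n : ℕ} (φ : C.scheme ⟶ ProjSpace k n)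
    (s : Fin (n + 1) → C.FunctionField) : Prop :=
  ∀ i : Fin (n + 1), ∃ ψ : HomogeneousLocalization.Away
      (MvPolynomial.homogeneousSubmodule (Fin (n + 1)) k) (MvPolynomial.X i) →+* C.FunctionField,
    C.scheme.fromSpecStalk (genericPoint C.scheme) ≫ φ =
      Spec.map (CommRingCat.ofHom ψ) ≫
        Proj.awayι _ (MvPolynomial.X i) (MvPolynomial.isHomogeneous_X k i) one_pos ∧
    ∀ (d : ℕ) (F : MvPolynomial (Fin (n + 1)) k)
      (hF : F ∈ MvPolynomial.homogeneousSubmodule (Fin (n + 1)) k (d • 1)),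
      ψ (HomogeneousLocalization.Away.mk _ (MvPolynomial.isHomogeneous_X k i) d F hF) =
        MvPolynomial.aeval s F / s i ^ d

/-- A divisor `E` is very ample if the complete linear system of `E` has no base points and the
morphism to projective space given by a basis of `H⁰(C, 𝒪(E))` is a closed immersion. -/
def Curve.IsVeryAmple (C : Curve k) (E : C.Divisor) : Prop :=
  ∃ (n : ℕ) (s : Fin (n + 1) → C.FunctionField),
    LinearIndependent k s ∧ (Submodule.span k (Set.range s) : Set C.FunctionField) = C.H0 E ∧
    (∀ p, ∃ j, C.ν p (s j) = -E p) ∧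
    ∃ φ : C.scheme ⟶ ProjSpace k n, IsClosedImmersion φ ∧ C.IsGivenBy φ s

end ProjectiveSpace

section Differentials

/-- `dΨ|_x = 0`: the differential of the function `Ψ` on the affine `k`-scheme `Spec S` vanishes in
the fibre `κ(x) ⊗ Ω_{S/k}` of the sheaf of Kähler differentials at the point `x`. -/
def DiffVanishesAt (k : Type*) {S : Type*} [Field k] [CommRing S] [Algebra k S] (Ψ : S)
    (x : PrimeSpectrum S) : Prop :=
  (1 : x.asIdeal.ResidueField) ⊗ₜ[S] KaehlerDifferential.D k S Ψ = 0

/-- The value `Ψ(x)`, a point of the affine line `Spec k[t]`: the image of the point `x` under the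
morphism `Spec S → Spec k[t]` with `t ↦ Ψ`. -/
def valueAt (k : Type*) {S : Type*} [Field k] [CommRing S] [Algebra k S] (Ψ : S)
    (x : PrimeSpectrum S) : PrimeSpectrum (Polynomial k) :=
  PrimeSpectrum.comap (Polynomial.aeval Ψ : Polynomial k →ₐ[k] S).toRingHom x

/-- The branch locus of `Ψ : Spec S → Spec k[t]`: the set of all `Ψ(x)` with `dΨ|_x = 0`. -/
def branchLocus (k : Type*) {S : Type*} [Field k] [CommRing S] [Algebra k S] (Ψ : S) :
    Set (PrimeSpectrum (Polynomial k)) :=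
  {𝔭 | ∃ x, DiffVanishesAt k Ψ x ∧ valueAt k Ψ x = 𝔭}

end Differentials

section Discriminant

/-- The splitting field over `K`, inside an algebraic closure of `K`, of an ideal `I` in a
`K`-algebra `S`: the composite of the normal closures over `K` of the residue fields at the primes
of `S` that contain `I`. -/
def splittingField (K : Type*) {S : Type*} [Field K] [CommRing S] [Algebra K S] (I : Ideal S) :
    IntermediateField K (AlgebraicClosure K) :=
  ⨆ P : {P : PrimeSpectrum S // I ≤ P.asIdeal},
    IntermediateField.normalClosure K P.1.asIdeal.ResidueField (AlgebraicClosure K)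

/-- The discriminant of a finite extension `L / K` with respect to an integrally closed domain `A`
with field of fractions `K`: the ideal of `A` generated by the discriminants of all `K`-bases of `L`
that consist of elements integral over `A`. -/
def discriminantIdeal (A K L : Type*) [CommRing A] [Field K] [Field L] [Algebra A K]
    [Algebra K L] : Ideal A :=
  Ideal.span {d | ∃ b : Module.Basis (Fin (Module.finrank K L)) K L,
    (∀ i, ((algebraMap K L).comp (algebraMap A K)).IsIntegralElem (b i)) ∧ algebraMap A K d = Algebra.discr K b}

end Discriminant

section Generic

variable (k : Type u) [Field k] (m : ℕ)

/-- The field `k(A')` of rational functions in the variables `A₁, …, Aₘ`. -/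
abbrev FieldA' : Type u := FractionRing (MvPolynomial (Fin m) k)

/-- The field `k(A) = k(A₀, A₁, …, Aₘ)`, as the fraction field of `k(A')[A₀]`. -/
abbrev FieldA : Type u := FractionRing (Polynomial (FieldA' k m))

variable {m}

/-- The variable `A_j` in `k(A')`. -/
def varA' (j : Fin m) : FieldA' k m :=
  algebraMap (MvPolynomial (Fin m) k) _ (MvPolynomial.X j)

variable (m) in
/-- The variable `A₀` in `k(A)`. -/
def varA₀ : FieldA k m := algebraMap (Polynomial (FieldA' k m)) _ Polynomial.X

variable {R : Type u} [CommRing R] [Algebra k R]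

/-- `Ψ = σ + f₀ + ∑ⱼ Aⱼ gⱼ`, a function on `Spec (k(A') ⊗ R)`. -/
def psi (σ f₀ : R) (g : Fin m → R) : FieldA' k m ⊗[k] R :=
  1 ⊗ₜ (σ + f₀) + ∑ j, varA' k j ⊗ₜ g j

/-- `L(𝓕_A) = σ + f₀ + A₀ + ∑ⱼ Aⱼ gⱼ`, a function on `Spec (k(A) ⊗ R)`. -/
def linearAtGeneric (σ f₀ : R) (g : Fin m → R) : FieldA k m ⊗[k] R :=
  1 ⊗ₜ (σ + f₀) + varA₀ k m ⊗ₜ 1 +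
    ∑ j, algebraMap (FieldA' k m) (FieldA k m) (varA' k j) ⊗ₜ g j

/-- The discriminant ideal in `k(A')[A₀]` of the splitting field of `L(𝓕_A)` over `k(A)`. -/
def discL (σ f₀ : R) (g : Fin m → R) : Ideal (Polynomial (FieldA' k m)) :=
  discriminantIdeal (Polynomial (FieldA' k m)) (FieldA k m)
    (splittingField (FieldA k m) (Ideal.span {linearAtGeneric k σ f₀ g}))

end Generic

end ShortInterval

end

open ShortInterval

noncomputable section

namespace ShortInterval

universe u

/-! ### Discriminants of unramified algebras -/

section DiscriminantUnramified

/-! Part 1 is a dimension count. Suppose that critical points x of Ψ₁ and y of Ψ₂ have equal values.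
Their residue fields embed in one field Ω over k(A') in which the values agree. Restriction to R
gives two homomorphisms R → Ω, each carrying a nonzero tangent vector (`exists_jet`). The two
vanishing differentials and the equality of values are three affine-linear relations between the
images of the Aⱼ. Their coefficients lie in a field L that is algebraic over the field generated by
the two points, so L has transcendence degree at most 2 over k. If the relations are independent,
the m algebraically independent elements Aⱼ have transcendence degree at most m - 3 over L, hence m
≤ 2 + (m - 3), which is absurd (`card_le_encard_of_linear_relations`).

Independence comes from E ≥ 3E₀: products of three functions in H⁰(E₀) lie in the span of 1 and the
gⱼ, and H⁰(E₀) separates points and tangent vectors, so such products separate 1-jets at two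
distinct points up to constants (`coefficients_eq_zero_of_jets`). If the two homomorphisms R → Ω
coincide, equality of values makes σ₁ - σ₂ vanish there. The point is then algebraic over k, and the
one remaining relation is already too many. Both cases are in `critical_values_ne`. Part 2 is a
reformulation.

Part 3 reduces to part 1: a maximal ideal P of k(A')[A₀] containing both discriminant ideals would
be a common critical value of -Ψ₁ and -Ψ₂. Indeed let A₀ act on S = k(A') ⊗ R as -Ψ. The pole
conditions make S finite over k(A')[A₀] (`IsVeryAmple.isIntegral_of_psi_mem_range`). If no critical
point lies over P, then S is unramified over P (`exists_forall_smul_D_eq_zero`). The images of S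
generate the splitting field, so near P it contains a finite unramified order, whose discriminant is
a unit at P (`exists_mem_discriminantIdeal_notMem`). -/

lemma trace_one_tmul {R B : Type*} (R' : Type*) [CommRing R] [CommRing B] [Algebra R B] [CommRing R'] [Algebra R R']
    [Module.Free R B] [Module.Finite R B] (x : B) :
    Algebra.trace R' (R' ⊗[R] B) (1 ⊗ₜ x) = algebraMap R R' (Algebra.trace R B x) := by
  rw [Algebra.trace_apply, Algebra.trace_apply, ← LinearMap.trace_baseChange]
  congr 1
  ext y
  simp

lemma discr_baseChange {R B : Type*} (R' : Type*) [CommRing R] [CommRing B] [Algebra R B] [CommRing R'] [Algebra R R']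
    [Module.Free R B] [Module.Finite R B] {ι : Type*} [Fintype ι] [DecidableEq ι] (b : ι → B) :
    Algebra.discr R' (fun i => (1 ⊗ₜ b i : R' ⊗[R] B)) = algebraMap R R' (Algebra.discr R b) := by
  rw [Algebra.discr_def, Algebra.discr_def, RingHom.map_det]
  congr 1
  ext i j
  simp [Algebra.traceMatrix_apply, Algebra.traceForm_apply, trace_one_tmul]

lemma discr_pi_basisFun (F n : Type*) [Field F] [Fintype n] [DecidableEq n] :
    Algebra.discr F (Pi.basisFun F n) = 1 := by
  rw [Algebra.discr_def]
  rw [← Matrix.det_one (n := n) (R := F)]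
  congr 1
  ext i j
  rw [Algebra.traceMatrix_apply, Algebra.traceForm_apply,
    Algebra.trace_apply, LinearMap.trace_eq_matrix_trace F (Pi.basisFun F n), Matrix.trace]
  simp only [Matrix.diag, LinearMap.toMatrix_apply, Pi.basisFun_repr, Pi.basisFun_apply,
    Algebra.coe_lmul_eq_mul, LinearMap.mul_apply', Pi.mul_apply, Pi.single_apply, Matrix.one_apply]
  simp [eq_comm]

/-- The standard basis of a split algebra has discriminant 1, and a change of basis multiplies
discriminants by the square of a determinant, so no basis can have discriminant 0. -/
lemma discr_ne_zero_of_algEquiv_pi {F n B : Type*} [Field F] [Fintype n] [CommRing B] [Algebra F B]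
    (e : B ≃ₐ[F] (n → F)) {ι : Type*} [Fintype ι] [DecidableEq ι] (b : Module.Basis ι F B) :
    Algebra.discr F b ≠ 0 := by
  classical
  let c : Module.Basis n F B := (Pi.basisFun F n).map e.symm.toLinearEquiv
  have hc : Algebra.discr F c = 1 := by
    rw [Algebra.discr_eq_discr_of_algEquiv c e, ← discr_pi_basisFun F n]
    congr 1
    ext i : 1
    simp [c]
  let eq : n ≃ ι := c.indexEquiv b
  intro h0
  have h1 : Algebra.discr F (b.reindex eq.symm) = 0 := by
    rw [Module.Basis.coe_reindex, Algebra.discr_reindex F b eq.symm, h0]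
  have := Algebra.discr_of_matrix_vecMul (A := F) (b.reindex eq.symm)
    ((b.reindex eq.symm).toMatrix c)
  rw [h1, mul_zero] at this
  have h2 : Matrix.vecMul (b.reindex eq.symm) (((b.reindex eq.symm).toMatrix c).map (algebraMap F B)) = c := by
    ext j
    rw [Matrix.vecMul, dotProduct]
    conv_rhs => rw [← (b.reindex eq.symm).sum_toMatrix_smul_self c j]
    refine Finset.sum_congr rfl fun i _ => ?_
    rw [Matrix.map_apply, Algebra.smul_def, mul_comm]
  rw [h2, hc] at this
  exact one_ne_zero this

/-- The discriminant commutes with base change. Over an algebraic closure of the residue field a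
finite unramified algebra splits into copies of the field, so the discriminant is nonzero modulo the
maximal ideal. -/
lemma isUnit_discr_of_formallyUnramified {R B : Type*} [CommRing R] [IsLocalRing R] [CommRing B] [Algebra R B]
    [Module.Finite R B] [Algebra.FormallyUnramified R B]
    {ι : Type*} [Fintype ι] [DecidableEq ι] (b : Module.Basis ι R B) :
    IsUnit (Algebra.discr R b) := by
  by_contra h
  have := Module.Free.of_basis b
  let F := AlgebraicClosure (IsLocalRing.ResidueField R)
  have h0 : algebraMap R F (Algebra.discr R b) = 0 := by
    rw [IsScalarTower.algebraMap_apply R (IsLocalRing.ResidueField R) F,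
      IsLocalRing.ResidueField.algebraMap_eq, (IsLocalRing.residue_eq_zero_iff _).mpr
      ((IsLocalRing.mem_maximalIdeal _).mpr h), map_zero]
  rw [← discr_baseChange] at h0
  have : Algebra.FormallyEtale F (F ⊗[R] B) := Algebra.FormallyEtale.of_formallyUnramified_of_field _ _
  have : IsArtinianRing (F ⊗[R] B) := isArtinian_of_tower F inferInstance
  have := Fintype.ofFinite (PrimeSpectrum (F ⊗[R] B))
  refine discr_ne_zero_of_algEquiv_pi (Algebra.FormallyEtale.equivPiOfIsSepClosed F (F ⊗[R] B))
    (b.baseChange F) ?_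
  rw [← h0]
  congr 1
  ext i
  simp

lemma isPrincipalIdealRing_of_isLocalization {A A' : Type*} [CommRing A] [IsPrincipalIdealRing A]
    [CommRing A'] [Algebra A A'] (M : Submonoid A) [IsLocalization M A'] : IsPrincipalIdealRing A' where
  principal I := by
    rw [← IsLocalization.map_under M A' I]
    infer_instance

/-- Kähler differentials killed by a non-element of `P` vanish on the subalgebra generated, over the
localization at `P`, by homomorphic images. -/
lemma formallyUnramified_adjoin_of_forall_exists {A A' S L : Type*} [CommRing A] [CommRing A']
    [Algebra A A'] [CommRing S] [Algebra A S] [CommRing L] [Algebra A L] [Algebra A' L]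
    [IsScalarTower A A' L] {c : A} (hc : IsUnit (algebraMap A A' c))
    (hD : ∀ s : S, c • KaehlerDifferential.D A S s = 0) (Z : Set L)
    (hZ : ∀ z ∈ Z, ∃ f : S →ₐ[A] L, z ∈ Set.range f ∧ ∀ s, f s ∈ Algebra.adjoin A' Z) :
    Algebra.FormallyUnramified A' (Algebra.adjoin A' Z) := by
  set B := Algebra.adjoin A' Z
  have h0 : ∀ b : B, KaehlerDifferential.D A' B b = 0 := by
    intro b
    have : KaehlerDifferential.D A' B = 0 := by
      refine Derivation.ext_of_adjoin_eq_top _ (Algebra.adjoin_adjoin_coe_preimage (R := A') (s := Z)) ?_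
      intro z hz
      obtain ⟨f, ⟨s, hs⟩, hf⟩ := hZ z hz
      let f' : S →ₐ[A] B := AlgHom.codRestrict f (B.restrictScalars A) hf
      let : Algebra S B := f'.toRingHom.toAlgebra
      have : IsScalarTower A S B := IsScalarTower.of_algebraMap_eq fun a => (f'.commutes a).symm
      have h := congrArg (KaehlerDifferential.map A A' S B) (hD s)
      rw [← algebraMap_smul S c, map_smul, KaehlerDifferential.map_D, map_zero] at h
      have e : algebraMap S B s = z := Subtype.ext hs
      rw [e, algebraMap_smul, ← algebraMap_smul A' c] at h
      simpa using (hc.smul_eq_zero).mp h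
    rw [this]; rfl
  refine ⟨?_⟩
  rw [← Submodule.subsingleton_iff B, ← subsingleton_iff_bot_eq_top, ← KaehlerDifferential.span_range_derivation,
    eq_comm, Submodule.span_eq_bot]
  rintro _ ⟨b, rfl⟩
  exact h0 b

/-- Over the localization at `P`, the images of `S` in `L` generate a finite unramified algebra with
fraction field `L`. It is free because the localization is a principal ideal domain, its
discriminant is a unit, and clearing denominators by elements outside `P` keeps the discriminant
outside `P`. -/
theorem exists_mem_discriminantIdeal_notMem {A K L S : Type*} [CommRing A] [IsDomain A]
    [IsPrincipalIdealRing A] [Field K] [Algebra A K] [IsFractionRing A K] [Field L] [Algebra K L]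
    [CommRing S] [Algebra A S] [Module.Finite A S] [Algebra A L] [IsScalarTower A K L]
    (P : Ideal A) [P.IsPrime] (hP : ∃ c ∉ P, ∀ s : S, c • KaehlerDifferential.D A S s = 0)
    (hL : IntermediateField.adjoin K (⋃ f : S →ₐ[A] L, Set.range f) = ⊤) :
    ∃ d ∈ discriminantIdeal A K L, d ∉ P := by
  classical
  obtain ⟨c, hcP, hc⟩ := hP
  let A' := Localization.subalgebra.ofField K P.primeCompl P.primeCompl_le_nonZeroDivisors
  have : IsLocalization.AtPrime A' P := Localization.subalgebra.isLocalization_ofField K P.primeCompl P.primeCompl_le_nonZeroDivisors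
  have : IsFractionRing A' K := Localization.subalgebra.isFractionRing_ofField K P.primeCompl P.primeCompl_le_nonZeroDivisors
  have : IsLocalRing A' := IsLocalization.AtPrime.isLocalRing A' P
  have : IsPrincipalIdealRing A' := isPrincipalIdealRing_of_isLocalization P.primeCompl
  have : IsScalarTower A A' L := IsScalarTower.of_algebraMap_eq fun a => by
    rw [IsScalarTower.algebraMap_apply A K L]; rfl
  have : IsScalarTower A' K L := IsScalarTower.of_algebraMap_eq fun a => rfl
  have : FaithfulSMul A' L := (faithfulSMul_iff_algebraMap_injective _ _).mpr (by
    rw [IsScalarTower.algebraMap_eq A' K L]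
    exact (algebraMap K L).injective.comp (IsFractionRing.injective A' K))
  obtain ⟨G, hG⟩ := (inferInstance : Algebra.FiniteType A S).out
  -- There may be many homomorphisms `f`, but the images of a finite generating set are roots of
  -- finitely many minimal polynomials, so `Z` is finite.
  let Z : Set L := ⋃ f : S →ₐ[A] L, f '' G
  have hint : ∀ z ∈ Z, IsIntegral A z := by
    intro z hz
    obtain ⟨f, s, -, rfl⟩ := Set.mem_iUnion.mp hz
    exact (Algebra.IsIntegral.isIntegral s).map f
  have hZfin : Z.Finite := by
    have : Z ⊆ ⋃ g ∈ G, (((minpoly A g).map (algebraMap A L)).rootSet L) := by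
      intro z hz
      obtain ⟨f, s, hs, rfl⟩ := Set.mem_iUnion.mp hz
      refine Set.mem_biUnion (Finset.mem_coe.mp hs) ?_
      rw [Polynomial.mem_rootSet]
      refine ⟨((minpoly.monic (Algebra.IsIntegral.isIntegral s)).map _).ne_zero, ?_⟩
      rw [Polynomial.coe_aeval_eq_eval, Polynomial.eval_map_algebraMap, Polynomial.aeval_algHom_apply,
        minpoly.aeval, map_zero]
    exact (G.finite_toSet.biUnion fun g _ => Polynomial.rootSet_finite _ _).subset this
  set B := Algebra.adjoin A' Z with hB
  have hfB : ∀ (f : S →ₐ[A] L) (s : S), f s ∈ B := by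
    intro f s
    have : s ∈ Algebra.adjoin A (G : Set S) := hG ▸ trivial
    have h2 : f s ∈ (Algebra.adjoin A (G : Set S)).map f := ⟨s, this, rfl⟩
    rw [AlgHom.map_adjoin] at h2
    have h3 : Algebra.adjoin A (f '' G) ≤ B.restrictScalars A :=
      Algebra.adjoin_le ((Set.subset_iUnion (fun f : S →ₐ[A] L => f '' (G : Set S)) f).trans Algebra.subset_adjoin)
    exact h3 h2
  have hunr : Algebra.FormallyUnramified A' B := by
    refine formallyUnramified_adjoin_of_forall_exists (A := A) (S := S)
      (IsLocalization.map_units A' (⟨c, hcP⟩ : P.primeCompl)) hc Z ?_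
    intro z hz
    obtain ⟨f, s, -, rfl⟩ := Set.mem_iUnion.mp hz
    exact ⟨f, ⟨s, rfl⟩, hfB f⟩
  have hfin : Module.Finite A' B :=
    Module.Finite.iff_fg.mpr (fg_adjoin_of_finite hZfin fun z hz => (hint z hz).tower_top)
  have : Module.IsTorsionFree A' L :=
    Module.isTorsionFree_iff_algebraMap_injective.mpr (FaithfulSMul.algebraMap_injective A' L)
  have : Module.IsTorsionFree A' B := Function.Injective.moduleIsTorsionFree B.val Subtype.val_injective fun _ _ => rfl
  have : Module.Free A' B := Module.free_of_finite_type_torsion_free'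
  have hmul : ∀ z : L, ∃ a : A', a ≠ 0 ∧ a • z ∈ B := by
    intro z
    have hz : z ∈ Algebra.adjoin K Z := by
      have h1 : (IntermediateField.adjoin K Z).toSubalgebra = Algebra.adjoin K Z :=
        IntermediateField.adjoin_toSubalgebra_of_isAlgebraic fun x hx =>
          ((hint x hx).tower_top (A := K)).isAlgebraic
      rw [← h1]
      have h2 : IntermediateField.adjoin K (⋃ f : S →ₐ[A] L, Set.range f) ≤ IntermediateField.adjoin K Z := by
        rw [IntermediateField.adjoin_le_iff]
        rintro _ hx
        obtain ⟨f, s, rfl⟩ := Set.mem_iUnion.mp hx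
        have h3 : B ≤ (IntermediateField.adjoin K Z).toSubalgebra.restrictScalars A' :=
          Algebra.adjoin_le (IntermediateField.subset_adjoin K Z)
        exact h3 (hfB f s)
      exact h2 (hL ▸ IntermediateField.mem_top)
    induction hz using Algebra.adjoin_induction with
    | mem x hx => exact ⟨1, one_ne_zero, by rw [one_smul]; exact Algebra.subset_adjoin hx⟩
    | algebraMap r =>
      obtain ⟨a, b, hb, rfl⟩ := IsFractionRing.div_surjective (A := A') r
      have hb0 : algebraMap A' K b ≠ 0 := by simpa using nonZeroDivisors.ne_zero hb
      refine ⟨b, nonZeroDivisors.ne_zero hb, ?_⟩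
      rw [Algebra.smul_def, IsScalarTower.algebraMap_apply A' K L, ← map_mul, mul_div_cancel₀ _ hb0,
        ← IsScalarTower.algebraMap_apply A' K L]
      exact B.algebraMap_mem a
    | add x y _ _ hx hy =>
      obtain ⟨a, ha, hax⟩ := hx
      obtain ⟨b, hb, hby⟩ := hy
      refine ⟨a * b, mul_ne_zero ha hb, ?_⟩
      rw [smul_add]
      refine add_mem ?_ ?_
      · rw [mul_comm, mul_smul]; exact B.smul_mem hax b
      · rw [mul_smul]; exact B.smul_mem hby a
    | mul x y _ _ hx hy =>
      obtain ⟨a, ha, hax⟩ := hx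
      obtain ⟨b, hb, hby⟩ := hy
      refine ⟨a * b, mul_ne_zero ha hb, ?_⟩
      rw [← smul_mul_smul_comm]
      exact mul_mem hax hby
  -- `B` is an order in `L`: inverting the nonzero elements of `A'` gives all of `L`, so an
  -- `A'`-basis of `B` is a `K`-basis of `L`.
  have : IsLocalization (Algebra.algebraMapSubmonoid B (nonZeroDivisors A')) L := by
    refine IsLocalization'.mk (Submonoid.IsLocalizationMap.mk ?_ ?_ ?_)
    · rintro ⟨_, a, ha, rfl⟩
      rw [isUnit_iff_ne_zero]
      intro h
      exact nonZeroDivisors.ne_zero ha (FaithfulSMul.algebraMap_injective A' L (by rw [map_zero]; exact h))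
    · intro z
      obtain ⟨a, ha, haz⟩ := hmul z
      refine ⟨⟨⟨a • z, haz⟩, ⟨algebraMap A' B a, a, mem_nonZeroDivisors_of_ne_zero ha, rfl⟩⟩, ?_⟩
      change z * algebraMap A' L a = a • z
      rw [Algebra.smul_def, mul_comm]
    · rintro x y h
      exact ⟨1, by rw [Subtype.ext h]⟩
  let b₀ := Module.Free.chooseBasis A' B
  let b₁ := b₀.localizationLocalization K (nonZeroDivisors A') L
  have hdisc : IsUnit (Algebra.discr A' b₀) := isUnit_discr_of_formallyUnramified b₀
  have hd1 : Algebra.discr K b₁ = algebraMap A' K (Algebra.discr A' b₀) :=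
    Algebra.discr_localizationLocalization A' (nonZeroDivisors A') L b₀
  let e : Module.Free.ChooseBasisIndex A' B ≃ Fin (Module.finrank K L) :=
    Fintype.equivFinOfCardEq (Module.finrank_eq_card_basis b₁).symm
  have : Module.Finite K L := Module.Finite.of_basis b₁
  have hint1 : ∀ i, ∃ m : P.primeCompl, IsIntegral A (m • b₁ i) := by
    intro i
    refine IsIntegral.exists_multiple_integral_of_isLocalization (Rₘ := A') P.primeCompl (b₁ i) ?_
    rw [Module.Basis.localizationLocalization_apply]
    exact (Algebra.IsIntegral.isIntegral (R := A') (b₀ i)).algebraMap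
  choose μ hμ using hint1
  -- One common denominator outside `P` scales the whole basis to elements integral over `A`; the
  -- discriminant changes by a power of `s`.
  let s : A := ∏ i, (μ i : A)
  have hs : s ∉ P := by
    have : s ∈ P.primeCompl := prod_mem fun i _ => (μ i).2
    exact this
  have hs0 : algebraMap A K s ≠ 0 := by
    intro h
    rw [← map_zero (algebraMap A K)] at h
    exact hs (by rw [IsFractionRing.injective A K h]; exact P.zero_mem)
  let b₂ := (b₁.reindex e).unitsSMul (fun _ => Units.mk0 _ hs0)
  have hb₂ : ∀ i, b₂ i = s • b₁ (e.symm i) := fun i => by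
    rw [Module.Basis.unitsSMul_apply, Module.Basis.reindex_apply, Units.smul_mk0, algebraMap_smul]
  have hint2 : ∀ i, IsIntegral A (b₂ i) := by
    intro i
    rw [hb₂, show s = (∏ j ∈ Finset.univ.erase (e.symm i), (μ j : A)) * μ (e.symm i) from
      (Finset.prod_erase_mul _ _ (Finset.mem_univ _)).symm, mul_smul]
    exact (hμ (e.symm i)).smul _
  have hd2 : Algebra.discr K b₂ = algebraMap A K (s ^ (2 * Module.finrank K L)) * Algebra.discr K b₁ := by
    have h1 := Algebra.discr_of_matrix_vecMul (A := K) (b₁.reindex e)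
      (Matrix.diagonal fun _ => algebraMap A K s)
    have h2 : Matrix.vecMul (b₁.reindex e) ((Matrix.diagonal fun _ : Fin (Module.finrank K L) =>
        algebraMap A K s).map (algebraMap K L)) = b₂ := by
      ext i
      rw [Matrix.diagonal_map (map_zero _), Matrix.vecMul_diagonal, hb₂, mul_comm,
        ← Algebra.smul_def, Module.Basis.reindex_apply, algebraMap_smul]
    rw [h2, Matrix.det_diagonal, Finset.prod_const, Finset.card_univ, Fintype.card_fin, ← pow_mul,
      Module.Basis.coe_reindex, Algebra.discr_reindex K b₁ e] at h1
    rw [h1, map_pow, mul_comm 2]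
  have hdint : IsIntegral A (Algebra.discr K b₂) := Algebra.discr_isIntegral K hint2
  obtain ⟨d, hd⟩ := IsIntegrallyClosed.isIntegral_iff.mp hdint
  refine ⟨d, Ideal.subset_span ⟨b₂, fun i => ?_, hd⟩, ?_⟩
  · have := hint2 i
    rwa [_root_.IsIntegral, IsScalarTower.algebraMap_eq A K L] at this
  · intro hdP
    rw [← IsLocalization.AtPrime.to_map_mem_maximal_iff A' P, IsLocalRing.mem_maximalIdeal] at hdP
    refine hdP ?_
    have : algebraMap A A' d = algebraMap A A' (s ^ (2 * Module.finrank K L)) * Algebra.discr A' b₀ := by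
      apply IsFractionRing.injective A' K
      rw [← IsScalarTower.algebraMap_apply, hd, hd2, hd1, map_mul, ← IsScalarTower.algebraMap_apply]
    rw [this, map_pow]
    exact ((IsLocalization.map_units A' (⟨s, hs⟩ : P.primeCompl)).pow _).mul hdisc

end DiscriminantUnramified

/-! ### Linear relations between algebraically independent elements -/

section Transcendence

/-- Independent linear relations between algebraically independent elements, with coefficients
algebraic over `k(s)`, are at most as many as the elements of `s`. -/
lemma card_le_encard_of_linear_relations {k Ω : Type*} [Field k] [Field Ω] [Algebra k Ω]
    (L : IntermediateField k Ω) (s : Set Ω)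
    (hL : ∀ z ∈ L, IsAlgebraic (Algebra.adjoin k s) z) {m : ℕ} (a : Fin m → Ω)
    (ha : AlgebraicIndependent k a) {ι : Type*} [Fintype ι] (v : ι → Fin m → L)
    (hv : LinearIndependent L v) (h : ∀ i, ∑ j, (v i j : Ω) * a j ∈ L) :
    (Fintype.card ι : ℕ∞) ≤ s.encard := by
  classical
  -- Modulo `L` the inhomogeneous relations become homogeneous: each `v i` lies in the kernel of
  -- `φ`, so the classes of the `a j` span a space of dimension at most `m - card ι`.
  let N : Submodule L Ω := LinearMap.range (Algebra.linearMap L Ω)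
  have hN : ∀ z, z ∈ N ↔ z ∈ L := fun z =>
    ⟨by rintro ⟨w, rfl⟩; exact w.2, fun hz => ⟨⟨z, hz⟩, rfl⟩⟩
  let φ : (Fin m → L) →ₗ[L] Ω ⧸ N := Fintype.linearCombination L (fun j => N.mkQ (a j))
  have hφ : ∀ c, φ c = N.mkQ (∑ j, (c j : Ω) * a j) := by
    intro c
    rw [Fintype.linearCombination_apply, map_sum]
    refine Finset.sum_congr rfl fun j _ => ?_
    rw [← map_smul, Algebra.smul_def]; rfl
  have hker : ∀ i, v i ∈ LinearMap.ker φ := fun i => by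
    rw [LinearMap.mem_ker, hφ, Submodule.mkQ_apply, Submodule.Quotient.mk_eq_zero, hN]; exact h i
  have h1 : Fintype.card ι ≤ Module.finrank L (LinearMap.ker φ) := by
    have : LinearIndependent L (fun i => (⟨v i, hker i⟩ : LinearMap.ker φ)) :=
      LinearIndependent.of_comp (LinearMap.ker φ).subtype hv
    exact this.fintype_card_le_finrank
  have h2 := φ.finrank_range_add_finrank_ker
  rw [Module.finrank_fin_fun] at h2
  obtain ⟨b, hbsub, hbspan, hbli⟩ := exists_linearIndependent L (Set.range fun j => N.mkQ (a j))
  have hbfin : b.Finite := (Set.finite_range _).subset hbsub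
  have := hbfin.fintype
  have hrange : LinearMap.range φ = Submodule.span L b := by
    rw [hbspan, Fintype.range_linearCombination]
  have h3 : Module.finrank L (LinearMap.range φ) = b.toFinset.card := by
    rw [hrange]; exact finrank_span_set_eq_card hbli
  have hb' : ∀ y ∈ b, ∃ z : Ω, N.mkQ z = y := fun y hy => (hbsub hy).imp' a fun _ h => h
  choose! f hf using hb'
  -- Lifts of a basis of that span. Every `a j` is an `L`-combination of `T` plus an element of `L`,
  -- hence algebraic over `k(s ∪ T)`. Comparing ranks in the algebraic independence matroid gives `m
  -- ≤ |s| + |T|`.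
  let T : Set Ω := f '' b
  have hTcard : T.encard ≤ (b.toFinset.card : ℕ∞) := by
    refine (Set.encard_image_le _ _).trans ?_
    rw [Set.encard_eq_coe_toFinset_card]
  let M := Subalgebra.algebraicClosure (Algebra.adjoin k (s ∪ T)) Ω
  have hmono : ∀ z, z ∈ (AlgebraicIndependent.matroid k Ω).closure s → z ∈ M := by
    intro z hz
    have := (AlgebraicIndependent.matroid k Ω).closure_subset_closure
      (Set.subset_union_left (s := s) (t := T)) hz
    rwa [AlgebraicIndependent.matroid_closure_eq] at this
  have hLM : ∀ z ∈ L, z ∈ M := fun z hz => hmono z (by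
    rw [AlgebraicIndependent.matroid_closure_eq]; exact hL z hz)
  have hTM : ∀ z ∈ T, z ∈ M := by
    intro z hz
    exact isAlgebraic_algebraMap (⟨z, Algebra.subset_adjoin (Or.inr hz)⟩ : Algebra.adjoin k (s ∪ T))
  have haM : ∀ j, a j ∈ M := by
    intro j
    have hj : N.mkQ (a j) ∈ Submodule.span L b := by
      rw [hbspan]; exact Submodule.subset_span ⟨j, rfl⟩
    have h4 : Submodule.span L b = (Submodule.span L T).map N.mkQ := by
      rw [Submodule.map_span]
      congr 1
      ext y
      constructor
      · exact fun hy => ⟨f y, ⟨y, hy, rfl⟩, hf y hy⟩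
      · rintro ⟨_, ⟨y', hy', rfl⟩, rfl⟩
        rw [hf y' hy']; exact hy'
    rw [h4] at hj
    obtain ⟨z, hz, hzj⟩ := hj
    have hzM : z ∈ M := by
      clear hzj
      induction hz using Submodule.span_induction with
      | mem x hx => exact hTM x hx
      | zero => exact M.zero_mem
      | add x y _ _ hx hy => exact M.add_mem hx hy
      | smul c x _ hx =>
        rw [Algebra.smul_def]
        exact M.mul_mem (hLM _ c.2) hx
    have hd : a j - z ∈ L := by
      rw [← hN, ← Submodule.Quotient.mk_eq_zero, ← Submodule.mkQ_apply, map_sub, hzj, sub_self]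
    rw [← sub_add_cancel (a j) z]
    exact M.add_mem (hLM _ hd) hzM
  have hrk : (Set.range a).encard ≤ (s ∪ T).encard := by
    have hind : (AlgebraicIndependent.matroid k Ω).Indep (Set.range a) := by
      rw [AlgebraicIndependent.matroid_indep_iff]
      exact ha.coe_range
    refine (hind.encard_le_eRk_of_subset (X := (AlgebraicIndependent.matroid k Ω).closure (s ∪ T)) ?_).trans ?_
    · rw [AlgebraicIndependent.matroid_closure_eq]
      rintro _ ⟨j, rfl⟩
      exact haM j
    · rw [Matroid.eRk_closure_eq]
      exact Matroid.eRk_le_encard _ _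
  have hra : (Set.range a).encard = m := by
    rw [← Set.image_univ, ha.injective.encard_image, Set.encard_univ]; simp
  rw [hra] at hrk
  have hrk2 := hrk.trans ((Set.encard_union_le s T).trans (add_le_add_right hTcard _))
  rcases eq_or_ne s.encard ⊤ with htop | htop
  · rw [htop]; exact le_top
  · lift s.encard to ℕ using htop with t
    norm_cast at hrk2 ⊢
    omega

end Transcendence

/-! ### Separation of 1-jets and genericity of critical values -/

section Jets

open TrivSqZeroExt

variable {k R Ω : Type*} [Field k] [CommRing R] [Algebra k R] [Field Ω] [Algebra k Ω]

/-- Triple products of separating functions separate the `1`-jets at two distinct points, in the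
quotient by the constants. -/
lemma coefficients_eq_zero_of_jets (W : Set R) (hW1 : (1 : R) ∈ W)
    (X Y : R →ₐ[k] DualNumber Ω)
    (hX : ∃ w ∈ W, (X w).snd ≠ 0) (hY : ∃ w ∈ W, (Y w).snd ≠ 0)
    (hXY : ∃ w ∈ W, (X w).fst ≠ (Y w).fst) (α β γ : Ω)
    (h : ∀ w₁ ∈ W, ∀ w₂ ∈ W, ∀ w₃ ∈ W, α * (X (w₁ * w₂ * w₃)).snd + β * (Y (w₁ * w₂ * w₃)).snd +
      γ * ((X (w₁ * w₂ * w₃)).fst - (Y (w₁ * w₂ * w₃)).fst) = 0) :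
    α = 0 ∧ β = 0 ∧ γ = 0 := by
  let Φ : R → DualNumber Ω × DualNumber Ω := fun r => (X r, Y r)
  let Λ : DualNumber Ω × DualNumber Ω →ₗ[Ω] Ω :=
    α • (sndHom Ω Ω ∘ₗ LinearMap.fst Ω _ _) + β • (sndHom Ω Ω ∘ₗ LinearMap.snd Ω _ _) +
      γ • ((fstHom Ω Ω Ω).toLinearMap ∘ₗ LinearMap.fst Ω _ _ - (fstHom Ω Ω Ω).toLinearMap ∘ₗ LinearMap.snd Ω _ _)
  have hΛ : ∀ p, Λ p = α * p.1.snd + β * p.2.snd + γ * (p.1.fst - p.2.fst) := fun p => rfl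
  let N := Submodule.span Ω (Φ '' W)
  have hN : ∀ p ∈ N * N * N, Λ p = 0 := by
    have : N * N * N ≤ LinearMap.ker Λ := by
      rw [Submodule.span_mul_span, Submodule.span_mul_span, Submodule.span_le]
      rintro _ ⟨_, ⟨_, ⟨w₁, h₁, rfl⟩, _, ⟨w₂, h₂, rfl⟩, rfl⟩, _, ⟨w₃, h₃, rfl⟩, rfl⟩
      simp only [SetLike.mem_coe, LinearMap.mem_ker, hΛ]
      have := h w₁ h₁ w₂ h₂ w₃ h₃
      rw [map_mul, map_mul, map_mul, map_mul] at this
      exact this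
    exact fun p hp => this hp
  have hΦ : ∀ w ∈ W, Φ w ∈ N := fun w hw => Submodule.subset_span ⟨w, hw, rfl⟩
  have h1N : (1 : DualNumber Ω × DualNumber Ω) ∈ N := by
    have := hΦ 1 hW1
    simp only [Φ, map_one] at this
    exact this
  obtain ⟨u₀, hu₀, hu⟩ := hXY
  obtain ⟨v₀, hv₀, hv⟩ := hX
  obtain ⟨w₀, hw₀, hw⟩ := hY
  have hu' : (Y u₀).fst - (X u₀).fst ≠ 0 := sub_ne_zero.mpr hu.symm
  -- Normalized separating elements: `u` takes the values 0 and 1 at the two points, while `v` and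
  -- `w` vanish at the first and second point respectively, with derivative 1 there.
  let u := ((Y u₀).fst - (X u₀).fst)⁻¹ • (Φ u₀ - (X u₀).fst • 1)
  let v := ((X v₀).snd)⁻¹ • (Φ v₀ - (X v₀).fst • 1)
  let w := ((Y w₀).snd)⁻¹ • (Φ w₀ - (Y w₀).fst • 1)
  have huN : u ∈ N := N.smul_mem _ (N.sub_mem (hΦ _ hu₀) (N.smul_mem _ h1N))
  have hvN : v ∈ N := N.smul_mem _ (N.sub_mem (hΦ _ hv₀) (N.smul_mem _ h1N))
  have hwN : w ∈ N := N.smul_mem _ (N.sub_mem (hΦ _ hw₀) (N.smul_mem _ h1N))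
  -- The products `v(1-u)²`, `wu²` and `u²` isolate `α`, `β` and then `γ`: a square kills both value
  -- and derivative at one of the points. Three factors are what this needs.
  have e1 := hN _ (Submodule.mul_mem_mul (Submodule.mul_mem_mul hvN (N.sub_mem h1N huN)) (N.sub_mem h1N huN))
  have e2 := hN _ (Submodule.mul_mem_mul (Submodule.mul_mem_mul hwN huN) huN)
  have e3 := hN _ (Submodule.mul_mem_mul (Submodule.mul_mem_mul huN huN) h1N)
  have ux : u.1.fst = 0 := by simp [u, Φ]
  have uy : u.2.fst = 1 := by simp [u, Φ, hu']
  have vx : v.1.fst = 0 := by simp [v, Φ]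
  have vx' : v.1.snd = 1 := by simp [v, Φ, hv]
  have wy : w.2.fst = 0 := by simp [w, Φ]
  have wy' : w.2.snd = 1 := by simp [w, Φ, hw]
  simp only [hΛ, Prod.fst_mul, Prod.snd_mul, fst_mul, snd_mul, Prod.fst_sub, Prod.snd_sub,
    Prod.fst_one, Prod.snd_one, fst_sub, snd_sub, fst_one, snd_one, ux, uy, vx, vx', wy, wy'] at e1 e2 e3
  simp at e1 e2 e3
  refine ⟨e1, e2, ?_⟩
  rw [e2] at e3
  simpa using e3

/-- Homomorphisms from a one-dimensional domain to a field have image of transcendence degree at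
most one, and algebraic image unless they are injective. -/
lemma exists_encard_le_one_isAlgebraic [IsDomain R] (htr : Algebra.trdeg k R ≤ 1) (x : R →ₐ[k] Ω) :
    ∃ s : Set Ω, s.encard ≤ 1 ∧ ((RingHom.ker x ≠ ⊥) → s = ∅) ∧
      ∀ r, IsAlgebraic (Algebra.adjoin k s) (x r) := by
  by_cases hx : RingHom.ker x = ⊥
  · obtain ⟨B, hB⟩ := exists_isTranscendenceBasis k R
    refine ⟨x '' B, (Set.encard_image_le _ _).trans ?_, fun h => (h hx).elim, fun r => ?_⟩
    · rw [← hB.cardinalMk_eq_trdeg] at htr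
      rw [Set.encard_le_one_iff_subsingleton, ← Set.subsingleton_coe, ← Cardinal.le_one_iff_subsingleton]
      exact htr
    · have h1 := hB.isAlgebraic.isAlgebraic r
      rw [Subtype.range_coe] at h1
      rw [← AlgHom.map_adjoin]
      let e : Algebra.adjoin k B →+* (Algebra.adjoin k B).map x :=
        ((x.comp (Algebra.adjoin k B).val).codRestrict ((Algebra.adjoin k B).map x) fun b => ⟨b, b.2, rfl⟩).toRingHom
      have he : Function.Injective e := fun b c h =>
        Subtype.ext ((RingHom.injective_iff_ker_eq_bot x.toRingHom).mpr hx (congrArg Subtype.val h))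
      exact h1.ringHom_of_comp_eq e x.toRingHom he rfl
  -- A transcendental value `x r` would make `r` a transcendence basis of `R`. A nonzero element of
  -- the kernel is algebraic over `k[r]`, so the kernel would contain a nonzero polynomial in `r`,
  -- making `x r` algebraic.
  · refine ⟨∅, by simp, fun _ => rfl, fun r => ?_⟩
    by_contra hr
    have hr' : Transcendental k (x r) := by
      intro h
      exact hr (h.extendScalars (algebraMap k _).injective)
    have hr0 : Transcendental k r := fun h => hr' (h.algHom x)
    have hind : AlgebraicIndependent k (fun _ : Unit => r) :=
      (algebraicIndependent_unique_type_iff).mpr hr0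
    have hB : IsTranscendenceBasis k (fun _ : Unit => r) :=
      hind.isTranscendenceBasis_of_lift_trdeg_le_of_finite (by simpa using htr)
    obtain ⟨z, hz, hz0⟩ := Submodule.exists_mem_ne_zero_of_ne_bot hx
    have halg := hB.isAlgebraic.isAlgebraic z
    have h1 : (RingHom.ker x).comap (algebraMap (Algebra.adjoin k (Set.range fun _ : Unit => r)) R) ≠ ⊥ :=
      Ideal.comap_ne_bot_of_algebraic_mem hz0 hz halg
    obtain ⟨p, hp, hp0⟩ := Submodule.exists_mem_ne_zero_of_ne_bot h1
    obtain ⟨P, hP⟩ : (p : R) ∈ (Polynomial.aeval r : Polynomial k →ₐ[k] R).range := by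
      rw [← Algebra.adjoin_singleton_eq_range_aeval]
      exact Algebra.adjoin_mono (by simp) p.2
    refine hr' ⟨P, ?_, ?_⟩
    · rintro rfl
      rw [map_zero] at hP
      exact hp0 (Subtype.ext hP.symm)
    · rw [Polynomial.aeval_algHom_apply]
      exact (congrArg x hP).trans hp

open scoped IntermediateField.algebraAdjoinAdjoin in
/-- The two critical values of generic members `τᵢ + ∑ⱼ aⱼ gⱼ` at points given by `1`-jets `X` and `Y`
differ. -/
theorem critical_values_ne [IsDomain R] (htr : Algebra.trdeg k R ≤ 1) (W : Set R) (hW1 : (1 : R) ∈ W)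
    {m : ℕ} (g : Fin m → R)
    (hWg : ∀ w₁ ∈ W, ∀ w₂ ∈ W, ∀ w₃ ∈ W,
      w₁ * w₂ * w₃ ∈ Submodule.span k (insert 1 (Set.range g)))
    (a : Fin m → Ω) (ha : AlgebraicIndependent k a) (τ₁ τ₂ : R) (hτ : τ₁ ≠ τ₂)
    (X Y : R →ₐ[k] DualNumber Ω)
    (hX : ∃ w ∈ W, (X w).snd ≠ 0) (hY : ∃ w ∈ W, (Y w).snd ≠ 0)
    (hXY : (∀ w ∈ W, (X w).fst = (Y w).fst) → ∀ r, (X r).fst = (Y r).fst)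
    (hXL : ∀ L : IntermediateField k Ω, (∀ r, (X r).fst ∈ L) → ∀ r, (X r).snd ∈ L)
    (hYL : ∀ L : IntermediateField k Ω, (∀ r, (Y r).fst ∈ L) → ∀ r, (Y r).snd ∈ L)
    (h₁ : (X τ₁).snd + ∑ j, (X (g j)).snd * a j = 0)
    (h₂ : (Y τ₂).snd + ∑ j, (Y (g j)).snd * a j = 0) :
    (X τ₁).fst + ∑ j, (X (g j)).fst * a j ≠ (Y τ₂).fst + ∑ j, (Y (g j)).fst * a j := by
  intro h₃
  let x : R →ₐ[k] Ω := (fstHom k Ω Ω).comp X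
  let y : R →ₐ[k] Ω := (fstHom k Ω Ω).comp Y
  obtain ⟨s, hs1, hs0, hs⟩ := exists_encard_le_one_isAlgebraic htr x
  obtain ⟨t, ht1, ht0, ht⟩ := exists_encard_le_one_isAlgebraic htr y
  have key : ∀ S : Set Ω, ∃ L : IntermediateField k Ω, ∀ z, z ∈ L ↔ IsAlgebraic (Algebra.adjoin k S) z := by
    intro S
    refine ⟨(algebraicClosure (IntermediateField.adjoin k S) Ω).restrictScalars k, fun z => ?_⟩
    rw [IntermediateField.mem_restrictScalars, mem_algebraicClosure_iff,
      IsFractionRing.isAlgebraic_iff (Algebra.adjoin k S) (IntermediateField.adjoin k S) Ω]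
  by_cases hxy : ∀ w ∈ W, (X w).fst = (Y w).fst
  · have hxy := hXY hxy
    -- The terms in the `g j` cancel in the equality of values, leaving `x τ₁ = x τ₂`; so `τ₁ - τ₂`
    -- is a nonzero element of the kernel.
    have hker : RingHom.ker x ≠ ⊥ := by
      intro h0
      apply hτ
      rw [← sub_eq_zero, ← Ideal.mem_bot, ← h0, RingHom.mem_ker]
      simp only [hxy, add_left_inj] at h₃
      change (X (τ₁ - τ₂)).fst = 0
      rw [hxy, map_sub, fst_sub, h₃, sub_self]
    rw [hs0 hker] at hs
    obtain ⟨L, hL⟩ := key ∅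
    have hxL : ∀ r, (X r).fst ∈ L := fun r => (hL _).mpr (hs r)
    have hxL' := hXL L hxL
    -- Otherwise the derivative would vanish on the span of 1 and the `g j`, which contains `W`.
    obtain ⟨j, hj⟩ : ∃ j, (X (g j)).snd ≠ 0 := by
      by_contra! hj
      obtain ⟨w, hw, hw0⟩ := hX
      refine hw0 ?_
      have h1 := hWg w hw 1 hW1 1 hW1
      rw [mul_one, mul_one] at h1
      have h2 : Submodule.span k (insert 1 (Set.range g)) ≤ LinearMap.ker ((sndHom Ω Ω).restrictScalars k ∘ₗ X.toLinearMap) := by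
        rw [Submodule.span_le]
        rintro _ (rfl | ⟨j, rfl⟩)
        · simp
        · simpa using hj j
      exact h2 h1
    have := card_le_encard_of_linear_relations L ∅ (fun z hz => (hL z).mp hz) a ha
      (fun (_ : Unit) j => ⟨(X (g j)).snd, hxL' _⟩) ?_ ?_
    · simp at this
    · rw [linearIndependent_unique_iff]
      intro h
      exact hj (congrArg Subtype.val (congrFun h j))
    · intro _
      have := neg_eq_of_add_eq_zero_right h₁
      rw [← this]
      exact neg_mem (hxL' _)
  · push Not at hxy
    obtain ⟨L, hL⟩ := key (s ∪ t)
    have hmono : ∀ S ⊆ s ∪ t, ∀ z, IsAlgebraic (Algebra.adjoin k S) z → z ∈ L := by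
      intro S hS z hz
      have := (AlgebraicIndependent.matroid k Ω).closure_subset_closure hS
      rw [AlgebraicIndependent.matroid_closure_eq, AlgebraicIndependent.matroid_closure_eq] at this
      exact (hL z).mpr (this hz)
    have hxL : ∀ r, (X r).fst ∈ L := fun r => hmono s Set.subset_union_left _ (hs r)
    have hyL : ∀ r, (Y r).fst ∈ L := fun r => hmono t Set.subset_union_right _ (ht r)
    have hxL' := hXL L hxL
    have hyL' := hYL L hyL
    -- Rows: the derivative at the first point, the derivative at the second, and the difference of
    -- values. Each point contributes at most one transcendental, so the bound reads `3 ≤ 2`.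
    have := card_le_encard_of_linear_relations L (s ∪ t) (fun z hz => (hL z).mp hz) a ha
      ![fun j => ⟨(X (g j)).snd, hxL' _⟩, fun j => ⟨(Y (g j)).snd, hyL' _⟩,
        fun j => ⟨(X (g j)).fst - (Y (g j)).fst, sub_mem (hxL _) (hyL _)⟩] ?_ ?_
    · have h2 := this.trans ((Set.encard_union_le s t).trans (add_le_add hs1 ht1))
      rw [Fintype.card_fin] at h2
      norm_num at h2
    · rw [Fintype.linearIndependent_iff]
      intro c hc
      rw [Fin.sum_univ_three] at hc
      have hc' : ∀ j, (c 0 : Ω) * (X (g j)).snd + c 1 * (Y (g j)).snd + c 2 * ((X (g j)).fst - (Y (g j)).fst) = 0 :=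
        fun j => congrArg Subtype.val (congrFun hc j)
      let Λ : R →ₗ[k] Ω := LinearMap.mulLeft k (c 0 : Ω) ∘ₗ (sndHom Ω Ω).restrictScalars k ∘ₗ X.toLinearMap +
        LinearMap.mulLeft k (c 1 : Ω) ∘ₗ (sndHom Ω Ω).restrictScalars k ∘ₗ Y.toLinearMap +
        LinearMap.mulLeft k (c 2 : Ω) ∘ₗ (x.toLinearMap - y.toLinearMap)
      have hΛ : Submodule.span k (insert 1 (Set.range g)) ≤ LinearMap.ker Λ := by
        rw [Submodule.span_le]
        rintro _ (rfl | ⟨j, rfl⟩)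
        · simp [Λ]
        · exact hc' j
      have := coefficients_eq_zero_of_jets W hW1 X Y hX hY hxy (c 0) (c 1) (c 2)
        fun w₁ h₁ w₂ h₂ w₃ h₃ => hΛ (hWg w₁ h₁ w₂ h₂ w₃ h₃)
      intro i
      fin_cases i
      · exact Subtype.ext this.1
      · exact Subtype.ext this.2.1
      · exact Subtype.ext this.2.2
    · intro i
      fin_cases i
      · have := neg_eq_of_add_eq_zero_right h₁
        change ∑ j, (X (g j)).snd * a j ∈ L
        rw [← this]
        exact neg_mem (hxL' _)
      · have := neg_eq_of_add_eq_zero_right h₂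
        change ∑ j, (Y (g j)).snd * a j ∈ L
        rw [← this]
        exact neg_mem (hyL' _)
      · change ∑ j, ((X (g j)).fst - (Y (g j)).fst) * a j ∈ L
        have : ∑ j, ((X (g j)).fst - (Y (g j)).fst) * a j = (Y τ₂).fst - (X τ₁).fst := by
          simp only [sub_mul, Finset.sum_sub_distrib]
          linear_combination h₃
        rw [this]
        exact sub_mem (hyL _) (hxL _)

end Jets

/-! ### From critical points of the scheme to jets over a common field -/

section CriticalPoints

open TrivSqZeroExt

/-- Two homomorphisms to fields with the same kernel become equal in a common extension. -/
lemma exists_field_comp_eq {A K₁ K₂ : Type u} [CommRing A] [Field K₁] [Field K₂] (φ : A →+* K₁)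
    (ψ : A →+* K₂) (h : RingHom.ker φ = RingHom.ker ψ) :
    ∃ (Ω : Type u) (_ : Field Ω) (i : K₁ →+* Ω) (j : K₂ →+* Ω), i.comp φ = j.comp ψ := by
  let P := RingHom.ker φ
  have hP : P.IsPrime := RingHom.ker_isPrime φ
  let κ := P.ResidueField
  let φ' : κ →+* K₁ := Ideal.ResidueField.lift P φ le_rfl fun a ha =>
    isUnit_iff_ne_zero.mpr fun h0 => ha h0
  let ψ' : κ →+* K₂ := Ideal.ResidueField.lift P ψ h.le fun a ha =>
    isUnit_iff_ne_zero.mpr fun h0 => ha (show a ∈ RingHom.ker φ from h ▸ h0)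
  let := φ'.toAlgebra
  let := ψ'.toAlgebra
  -- Both fields extend the residue field of the common kernel, and any residue field of their
  -- tensor product is a compositum.
  obtain ⟨M, hM⟩ := Ideal.exists_maximal (K₁ ⊗[κ] K₂)
  let := Ideal.Quotient.field M
  refine ⟨K₁ ⊗[κ] K₂ ⧸ M, inferInstance,
    (Ideal.Quotient.mk M).comp Algebra.TensorProduct.includeLeftRingHom,
    (Ideal.Quotient.mk M).comp Algebra.TensorProduct.includeRight.toRingHom, ?_⟩
  ext a
  have h1 : φ a = algebraMap κ K₁ (algebraMap A κ a) := (Ideal.ResidueField.lift_algebraMap ..).symm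
  have h2 : ψ a = algebraMap κ K₂ (algebraMap A κ a) := (Ideal.ResidueField.lift_algebraMap ..).symm
  simp only [RingHom.comp_apply, h1, h2]
  congr 1
  simp [Algebra.TensorProduct.includeLeftRingHom, Algebra.algebraMap_eq_smul_one]

variable {k R Ω : Type*} [Field k] [CommRing R] [Algebra k R] [Field Ω] [Algebra k Ω]

/-- A point of `Spec R` at which the cotangent space is nonzero underlies a nontrivial `1`-jet defined
over its residue field. -/
lemma exists_jet (hR : ∀ q : PrimeSpectrum R, Nontrivial (q.asIdeal.ResidueField ⊗[R] KaehlerDifferential k R))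
    (f : R →ₐ[k] Ω) :
    ∃ X : R →ₐ[k] DualNumber Ω, (∀ r, (X r).fst = f r) ∧ (∃ r, (X r).snd ≠ 0) ∧
      ∀ L : IntermediateField k Ω, (∀ r, f r ∈ L) → ∀ r, (X r).snd ∈ L := by
  let q := RingHom.ker f
  have hq : q.IsPrime := RingHom.ker_isPrime f
  let κ := q.ResidueField
  let ι : κ →+* Ω := Ideal.ResidueField.lift q f.toRingHom le_rfl fun a ha =>
    isUnit_iff_ne_zero.mpr fun h0 => ha h0
  have hι : ∀ r, ι (algebraMap R κ r) = f r := fun r => Ideal.ResidueField.lift_algebraMap ..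
  have := hR ⟨q, hq⟩
  obtain ⟨z, hz⟩ := exists_ne (0 : κ ⊗[R] KaehlerDifferential k R)
  -- A functional on the cotangent fibre is a derivation `δ` of `R` into the residue field, and `f +
  -- ε δ` is the jet.
  obtain ⟨θ, hθ⟩ : ∃ θ : Module.Dual κ (κ ⊗[R] KaehlerDifferential k R), θ z ≠ 0 := by
    by_contra! h
    exact hz ((Module.forall_dual_apply_eq_zero_iff κ z).mp h)
  let δ : R → κ := fun r => θ (1 ⊗ₜ KaehlerDifferential.D k R r)
  have hmul : ∀ a b, δ (a * b) = algebraMap R κ a * δ b + algebraMap R κ b * δ a := by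
    intro a b
    simp only [δ, Derivation.leibniz, TensorProduct.tmul_add, map_add, TensorProduct.tmul_smul]
    rw [← algebraMap_smul κ a, ← algebraMap_smul κ b, map_smul, map_smul, smul_eq_mul, smul_eq_mul]
  let X : R →ₐ[k] DualNumber Ω := AlgHom.mk
    { toFun := fun r => inl (f r) + inr (ι (δ r))
      map_one' := by
        simp [δ]
      map_mul' := fun a b => by
        ext
        · simp
        · simp [hmul, hι]
          ring
      map_zero' := by simp [δ]
      map_add' := fun a b => by
        ext
        · simp
        · simp [δ, TensorProduct.tmul_add] }
    fun c => by
      ext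
      · simp [TrivSqZeroExt.algebraMap_eq_inl']
      · simp [TrivSqZeroExt.algebraMap_eq_inl', δ]
  have hXf : ∀ r, (X r).fst = f r := fun r => by simp [X]
  have hXs : ∀ r, (X r).snd = ι (δ r) := fun r => by simp [X]
  refine ⟨X, hXf, ?_, ?_⟩
  · by_contra! h
    refine hθ ?_
    have hδ : ∀ r, δ r = 0 := fun r => ι.injective (by rw [← hXs, h, map_zero])
    have h1 : ∀ ω : KaehlerDifferential k R, θ (1 ⊗ₜ ω) = 0 := by
      intro ω
      have : ω ∈ Submodule.span R (Set.range (KaehlerDifferential.D k R)) := by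
        rw [KaehlerDifferential.span_range_derivation]; trivial
      induction this using Submodule.span_induction with
      | mem x hx => obtain ⟨r, rfl⟩ := hx; exact hδ r
      | zero => simp
      | add x y _ _ hx hy => rw [TensorProduct.tmul_add, map_add, hx, hy, add_zero]
      | smul a x _ hx => rw [TensorProduct.tmul_smul, ← algebraMap_smul κ a, map_smul, hx, smul_zero]
    clear hz hθ
    induction z using TensorProduct.induction_on with
    | zero => simp
    | tmul a ω =>
      rw [← mul_one a, ← smul_eq_mul, ← TensorProduct.smul_tmul', map_smul, h1, smul_zero]
    | add x y hx hy => rw [map_add, hx, hy, add_zero]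
  -- `δ` takes values in the fraction field of `R ⧸ q`, so its values are quotients of values of
  -- `f`.
  · intro L hL r
    rw [hXs]
    obtain ⟨a, b, hb, hab⟩ := IsFractionRing.div_surjective (A := R ⧸ q) (δ r)
    obtain ⟨a, rfl⟩ := Ideal.Quotient.mk_surjective a
    obtain ⟨b, rfl⟩ := Ideal.Quotient.mk_surjective b
    rw [← hab, map_div₀]
    exact div_mem (by rw [show ι (algebraMap (R ⧸ q) κ (Ideal.Quotient.mk q a)) = f a from hι a]; exact hL a)
      (by rw [show ι (algebraMap (R ⧸ q) κ (Ideal.Quotient.mk q b)) = f b from hι b]; exact hL b)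

/-- The value of a function at a `1`-jet over a point where its differential vanishes is constant. -/
lemma snd_eq_zero_of_diffVanishesAt {F S : Type*} [Field F] [CommRing S] [Algebra F S] [Algebra F Ω]
    (Ψ : S) (x : PrimeSpectrum S) (i : x.asIdeal.ResidueField →+* Ω) (X : S →ₐ[F] DualNumber Ω)
    (hX : ∀ s, (X s).fst = i (algebraMap S _ s)) (h : DiffVanishesAt F Ψ x) : (X Ψ).snd = 0 := by
  let := i.toAlgebra
  let : Algebra S Ω := (i.comp (algebraMap S _)).toAlgebra
  have : IsScalarTower S x.asIdeal.ResidueField Ω := IsScalarTower.of_algebraMap_eq fun _ => rfl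
  have : IsScalarTower F S Ω := IsScalarTower.of_algebraMap_eq fun c => by
    have h1 := hX (algebraMap F S c)
    rw [AlgHom.commutes, TrivSqZeroExt.algebraMap_eq_inl', fst_inl] at h1
    exact h1
  have hsmul : ∀ (s : S) (z : Ω), s • z = (X s).fst * z := fun s z => by
    rw [hX, Algebra.smul_def]; rfl
  let D : Derivation F S Ω := Derivation.mk'
    ((sndHom Ω Ω).restrictScalars F ∘ₗ X.toLinearMap) fun a b => by
      change (X (a * b)).snd = a • (X b).snd + b • (X a).snd
      rw [map_mul, snd_mul, hsmul, hsmul, smul_eq_mul, MulOpposite.smul_eq_mul_unop, MulOpposite.unop_op,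
        mul_comm (X a).snd]
  have h2 := congrArg (D.liftKaehlerDifferential.liftBaseChange x.asIdeal.ResidueField) h
  rw [LinearMap.liftBaseChange_tmul, one_smul, map_zero, Derivation.liftKaehlerDifferential_comp_D] at h2
  exact h2

/-- The critical values of `σ₁ + f₀ + ∑ Aⱼ gⱼ` and `σ₂ + f₀ + ∑ Aⱼ gⱼ` are disjoint when triple
products of functions separating points and tangent vectors are combinations of `1` and the `gⱼ`. -/
theorem not_exists_common_critical_value {k R : Type u} [Field k] [CommRing R] [IsDomain R]
    [Algebra k R] (htr : Algebra.trdeg k R ≤ 1)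
    (hR : ∀ q : PrimeSpectrum R, Nontrivial (q.asIdeal.ResidueField ⊗[R] KaehlerDifferential k R))
    (W : Set R) (hW1 : (1 : R) ∈ W)
    (hW : ∀ (T : Type u) [CommRing T] (x y : R →+* T), Set.EqOn x y W → x = y)
    {m : ℕ} (g : Fin m → R)
    (hWg : ∀ w₁ ∈ W, ∀ w₂ ∈ W, ∀ w₃ ∈ W,
      w₁ * w₂ * w₃ ∈ Submodule.span k (insert 1 (Set.range g)))
    (f₀ σ₁ σ₂ : R) (hσ : σ₁ ≠ σ₂) :
    ¬ ∃ x y : PrimeSpectrum (FieldA' k m ⊗[k] R),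
      DiffVanishesAt (FieldA' k m) (psi k σ₁ f₀ g) x ∧
      DiffVanishesAt (FieldA' k m) (psi k σ₂ f₀ g) y ∧
      valueAt (FieldA' k m) (psi k σ₁ f₀ g) x = valueAt (FieldA' k m) (psi k σ₂ f₀ g) y := by
  rintro ⟨x, y, hx, hy, hxy⟩
  let F := FieldA' k m
  let S := F ⊗[k] R
  let evx : Polynomial F →+* x.asIdeal.ResidueField :=
    (algebraMap S _).comp (Polynomial.aeval (psi k σ₁ f₀ g) : Polynomial F →ₐ[F] S).toRingHom
  let evy : Polynomial F →+* y.asIdeal.ResidueField :=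
    (algebraMap S _).comp (Polynomial.aeval (psi k σ₂ f₀ g) : Polynomial F →ₐ[F] S).toRingHom
  have hker : RingHom.ker evx = RingHom.ker evy := by
    have := congrArg PrimeSpectrum.asIdeal hxy
    rw [RingHom.ker_eq_comap_bot, RingHom.ker_eq_comap_bot, ← Ideal.comap_comap, ← Ideal.comap_comap,
      ← RingHom.ker_eq_comap_bot, ← RingHom.ker_eq_comap_bot, Ideal.ker_algebraMap_residueField,
      Ideal.ker_algebraMap_residueField]
    exact this
  obtain ⟨Ω, _, i, j, hij⟩ := exists_field_comp_eq evx evy hker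
  -- The `F`-structure comes from `x`; the embedding through `y` respects it because `i` and `j`
  -- agree on the constants of `F[t]`.
  let : Algebra F Ω := (i.comp (algebraMap F x.asIdeal.ResidueField)).toAlgebra
  let : Algebra k Ω := ((algebraMap F Ω).comp (algebraMap k F)).toAlgebra
  have : IsScalarTower k F Ω := IsScalarTower.of_algebraMap_eq fun _ => rfl
  have hjF : ∀ c : F, j (algebraMap S _ (algebraMap F S c)) = algebraMap F Ω c := by
    intro c
    have := (RingHom.congr_fun hij (Polynomial.C c)).symm
    simp only [RingHom.comp_apply, evx, evy, AlgHom.toRingHom_eq_coe, RingHom.coe_coe,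
      Polynomial.aeval_C] at this
    exact this
  have hiF : ∀ c : F, i (algebraMap S _ (algebraMap F S c)) = algebraMap F Ω c := fun c => rfl
  let x' : S →ₐ[F] Ω := { i.comp (algebraMap S _) with commutes' := hiF }
  let y' : S →ₐ[F] Ω := { j.comp (algebraMap S _) with commutes' := hjF }
  let fx : R →ₐ[k] Ω := (x'.restrictScalars k).comp Algebra.TensorProduct.includeRight
  let fy : R →ₐ[k] Ω := (y'.restrictScalars k).comp Algebra.TensorProduct.includeRight
  obtain ⟨X, hX, hX', hXL⟩ := exists_jet hR fx
  obtain ⟨Y, hY, hY', hYL⟩ := exists_jet hR fy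
  let a : Fin m → Ω := fun l => algebraMap F Ω (varA' k l)
  have ha : AlgebraicIndependent k a := by
    have h1 : AlgebraicIndependent k (MvPolynomial.X : Fin m → MvPolynomial (Fin m) k) :=
      MvPolynomial.algebraicIndependent_X (Fin m) k
    have h2 := h1.map' (f := IsScalarTower.toAlgHom k _ F) (IsFractionRing.injective _ _)
    exact h2.map' (f := IsScalarTower.toAlgHom k F Ω) (algebraMap F Ω).injective
  have hext : ∀ Z : R →ₐ[k] DualNumber Ω, ∃ Z' : S →ₐ[F] DualNumber Ω,
      ∀ (c : F) (r : R), Z' (c ⊗ₜ r) = algebraMap F Ω c • Z r := by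
    intro Z
    refine ⟨Algebra.TensorProduct.lift (Algebra.ofId F _) Z fun _ _ => Commute.all _ _, fun c r => ?_⟩
    rw [Algebra.TensorProduct.lift_tmul, Algebra.ofId_apply, ← Algebra.smul_def, algebraMap_smul]
  have hval : ∀ (Z : R →ₐ[k] DualNumber Ω) (Z' : S →ₐ[F] DualNumber Ω),
      (∀ (c : F) (r : R), Z' (c ⊗ₜ r) = algebraMap F Ω c • Z r) → ∀ σ,
      Z' (psi k σ f₀ g) = Z (σ + f₀) + ∑ l, a l • Z (g l) := by
    intro Z Z' h σ
    rw [psi, map_add, map_sum, h, map_one, one_smul]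
    congr 1
    exact Finset.sum_congr rfl fun l _ => h _ _
  obtain ⟨X', hX1⟩ := hext X
  obtain ⟨Y', hY1⟩ := hext Y
  have hfst' : ∀ (Z : R →ₐ[k] DualNumber Ω) (Z' : S →ₐ[F] DualNumber Ω) (z : S →ₐ[F] Ω),
      (∀ (c : F) (r : R), Z' (c ⊗ₜ r) = algebraMap F Ω c • Z r) →
      (∀ r, (Z r).fst = z (1 ⊗ₜ r)) → ∀ s, (Z' s).fst = z s := by
    intro Z Z' z h1 h2 s
    induction s using TensorProduct.induction_on with
    | zero => simp
    | tmul c r =>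
      have : (c ⊗ₜ r : S) = c • (1 ⊗ₜ r) := by rw [TensorProduct.smul_tmul', smul_eq_mul, mul_one]
      rw [h1, fst_smul, h2, smul_eq_mul, this, map_smul, Algebra.smul_def]
    | add s t hs ht => rw [map_add, fst_add, hs, ht, map_add]
  have hXfst : ∀ s, (X' s).fst = i (algebraMap S _ s) := hfst' X X' x' hX1 hX
  have hYfst : ∀ s, (Y' s).fst = j (algebraMap S _ s) := hfst' Y Y' y' hY1 hY
  have hsx := snd_eq_zero_of_diffVanishesAt (F := F) _ x i X' hXfst hx
  have hsy := snd_eq_zero_of_diffVanishesAt (F := F) _ y j Y' hYfst hy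
  have hfst : (X' (psi k σ₁ f₀ g)).fst = (Y' (psi k σ₂ f₀ g)).fst := by
    rw [hXfst, hYfst]
    have := RingHom.congr_fun hij Polynomial.X
    simp only [RingHom.comp_apply, evx, evy, AlgHom.toRingHom_eq_coe, RingHom.coe_coe,
      Polynomial.aeval_X] at this
    exact this
  rw [hval X X' hX1] at hsx hfst
  rw [hval Y Y' hY1] at hsy hfst
  -- Separation of tangent vectors follows from the uniqueness property `hW`, applied to a jet and
  -- to the constant jet over the same point.
  have hsep : ∀ Z : R →ₐ[k] DualNumber Ω, (∃ r, (Z r).snd ≠ 0) → ∃ w ∈ W, (Z w).snd ≠ 0 := by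
    intro Z ⟨r, hr⟩
    by_contra! h
    have := hW (DualNumber Ω) Z.toRingHom (((inlAlgHom k Ω Ω).comp (fstHom k Ω Ω)).comp Z).toRingHom
      fun w hw => by
        ext
        · simp
        · simpa using h w hw
    have := congrArg snd (RingHom.congr_fun this r)
    simp at this
    exact hr this
  refine critical_values_ne htr W hW1 g hWg a ha (σ₁ + f₀) (σ₂ + f₀) (by simpa using hσ) X Y
    (hsep X hX') (hsep Y hY') ?_ (fun L hL => hXL L fun r => hX r ▸ hL r)
    (fun L hL => hYL L fun r => hY r ▸ hL r) ?_ ?_ ?_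
  · intro h r
    rw [hX, hY]
    exact RingHom.congr_fun (hW Ω fx.toRingHom fy.toRingHom fun w hw => by
      have := h w hw
      rwa [hX, hY] at this) r
  · simpa [snd_sum, mul_comm] using hsx
  · simpa [snd_sum, mul_comm] using hsy
  · simpa [fst_sum, mul_comm] using hfst

end CriticalPoints

/-! ### Smooth algebras of relative dimension one over a field -/

section StandardSmooth

variable (k : Type u) {B : Type u} [Field k] [CommRing B] [Algebra k B]

theorem exists_etale_polynomial (k B : Type u) [Field k] [CommRing B] [Algebra k B]
    [Algebra.IsStandardSmoothOfRelativeDimension 1 k B] : ∃ f : Polynomial k →ₐ[k] B, f.toRingHom.Etale := by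
  obtain ⟨g, hg⟩ := Algebra.IsStandardSmoothOfRelativeDimension.exists_etale_mvPolynomial 1 k B
  let e : Polynomial k ≃ₐ[k] MvPolynomial (Fin 1) k := (MvPolynomial.uniqueAlgEquiv k (Fin 1)).symm
  refine ⟨g.comp e.toAlgHom, ?_⟩
  have he : e.toRingEquiv.toRingHom.Etale := RingHom.Etale.of_bijective e.bijective
  exact RingHom.Etale.stableUnderComposition _ _ he hg

/-- An étale coordinate makes `B` unramified over `k[t]`, so the maximal ideal of the local ring is
generated by the image of a prime of `k[t]`, which is principal. -/
theorem isPrincipal_maximalIdeal_localization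
    [Algebra.IsStandardSmoothOfRelativeDimension 1 k B] (q : Ideal B) [q.IsPrime] :
    (IsLocalRing.maximalIdeal (Localization.AtPrime q)).IsPrincipal := by
  obtain ⟨f, hf⟩ := exists_etale_polynomial k B
  algebraize [f.toRingHom]
  let p := q.under (Polynomial k)
  have hU : Algebra.IsUnramifiedAt (Polynomial k) q :=
    Algebra.FormallyUnramified.comp _ B _
  let _ := Localization.AtPrime.algebraOfLiesOver p q
  have := ((Algebra.isUnramifiedAt_iff_map_eq (Polynomial k) p q).mp hU).2
  rw [← this]
  obtain ⟨a, ha⟩ := IsPrincipalIdealRing.principal p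
  rw [ha]
  exact ⟨⟨_, (Ideal.map_span _ _).trans (by rw [Set.image_singleton])⟩⟩

/-- For an étale coordinate `t`, the fraction field of `B` is unramified and essentially of finite
type over `k(t)`, hence finite. -/
theorem trdeg_le_one [Algebra.IsStandardSmoothOfRelativeDimension 1 k B] [IsDomain B] : Algebra.trdeg k B ≤ 1 := by
  obtain ⟨f, hf⟩ := exists_etale_polynomial k B
  algebraize [f.toRingHom]
  have : IsScalarTower k (Polynomial k) B := .of_algebraMap_eq' f.comp_algebraMap.symm
  have : FaithfulSMul (Polynomial k) B := inferInstance
  let K := FractionRing (Polynomial k)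
  let F := FractionRing B
  let _ : Algebra K F := FractionRing.liftAlgebra _ _
  have : Algebra.FormallyUnramified (Polynomial k) F := .comp _ B _
  have : Algebra.EssFiniteType (Polynomial k) F := .comp _ B _
  have : Algebra.FormallyUnramified K F := .of_restrictScalars (Polynomial k) _ _
  have : Algebra.EssFiniteType K F := .of_comp (Polynomial k) _ _
  have : Module.Finite K F := Algebra.FormallyUnramified.finite_of_free K F
  have : Algebra.IsAlgebraic (Polynomial k) F :=
    (IsFractionRing.comap_isAlgebraic_iff (K := K)).mpr inferInstance
  have : Algebra.IsAlgebraic (Polynomial k) B :=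
    ⟨fun b => (isAlgebraic_algebraMap_iff (IsFractionRing.injective B F)).mp
      (Algebra.IsAlgebraic.isAlgebraic (R := Polynomial k) (algebraMap B F b))⟩
  rw [← trdeg_add_eq k (Polynomial k), Polynomial.trdeg_of_isDomain, trdeg_eq_zero,
    add_zero]

theorem finrank_tensorProduct_kaehlerDifferential
    [Algebra.IsStandardSmoothOfRelativeDimension 1 k B] (κ : Type u) [Field κ] [Algebra B κ] :
    Module.finrank κ (κ ⊗[B] KaehlerDifferential k B) = 1 := by
  have : Algebra.IsStandardSmooth k B :=
    Algebra.IsStandardSmoothOfRelativeDimension.isStandardSmooth 1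
  have : Nontrivial B := (algebraMap B κ).domain_nontrivial
  rw [Module.finrank_baseChange, Module.finrank,
    Algebra.IsStandardSmoothOfRelativeDimension.rank_kaehlerDifferential 1]
  simp

end StandardSmooth

section LocallyStandardSmooth

variable {k R : Type u} [Field k] [CommRing R] [Algebra k R]

theorem exists_away_isStandardSmooth
    (h : RingHom.Locally (RingHom.IsStandardSmoothOfRelativeDimension 1) (algebraMap k R))
    (q : Ideal R) [q.IsPrime] : ∃ t ∉ q,
      Algebra.IsStandardSmoothOfRelativeDimension 1 k (Localization.Away t) := by
  obtain ⟨s, hs, H⟩ := h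
  obtain ⟨t, hts, htq⟩ : ∃ t ∈ s, t ∉ q := by
    by_contra! hc
    exact ‹q.IsPrime›.ne_top (top_le_iff.mp (hs ▸ Ideal.span_le.mpr hc))
  refine ⟨t, htq, ?_⟩
  have := H t hts
  rw [← IsScalarTower.algebraMap_eq] at this
  exact (RingHom.isStandardSmoothOfRelativeDimension_algebraMap 1).mp this

theorem isPrincipal_maximalIdeal_localization_of_locally
    (h : RingHom.Locally (RingHom.IsStandardSmoothOfRelativeDimension 1) (algebraMap k R))
    (q : Ideal R) [q.IsPrime] :
    (IsLocalRing.maximalIdeal (Localization.AtPrime q)).IsPrincipal := by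
  obtain ⟨t, htq, ht⟩ := exists_away_isStandardSmooth h q
  have hd : Disjoint (Submonoid.powers t : Set R) q := by
    rw [Set.disjoint_left]
    rintro _ ⟨n, rfl⟩ hn
    exact htq (Ideal.IsPrime.mem_of_pow_mem ‹_› n hn)
  let q' := q.map (algebraMap R (Localization.Away t))
  have : q'.IsPrime := IsLocalization.isPrime_of_isPrime_disjoint _ _ q ‹_› hd
  have hq' : q'.comap (algebraMap R (Localization.Away t)) = q :=
    IsLocalization.under_map_of_isPrime_disjoint _ _ ‹_› hd
  have hl : IsLocalization.AtPrime (Localization.AtPrime q') q := by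
    have := IsLocalization.isLocalization_isLocalization_atPrime_isLocalization
      (Submonoid.powers t) (Localization.AtPrime q') q'
    simpa only [hq'] using this
  let e := IsLocalization.algEquiv q.primeCompl (Localization.AtPrime q') (Localization.AtPrime q)
  have hp := isPrincipal_maximalIdeal_localization k q'
  obtain ⟨a, ha⟩ := hp
  have he : (IsLocalRing.maximalIdeal (Localization.AtPrime q')).map e.toRingEquiv.toRingHom =
      IsLocalRing.maximalIdeal (Localization.AtPrime q) := IsLocalRing.map_ringEquiv_maximalIdeal e.toRingEquiv
  rw [← he, ha]
  exact ⟨⟨_, (Ideal.map_span _ _).trans (by rw [Set.image_singleton])⟩⟩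

theorem trdeg_le_one_of_locally [IsDomain R]
    (h : RingHom.Locally (RingHom.IsStandardSmoothOfRelativeDimension 1) (algebraMap k R)) :
    Algebra.trdeg k R ≤ 1 := by
  obtain ⟨t, htq, ht⟩ := exists_away_isStandardSmooth h (⊥ : Ideal R)
  have ht0 : t ≠ 0 := htq
  have hle : Submonoid.powers t ≤ nonZeroDivisors R := powers_le_nonZeroDivisors_of_noZeroDivisors ht0
  have : IsDomain (Localization.Away t) := IsLocalization.isDomain_localization hle
  exact (trdeg_le_of_injective (IsScalarTower.toAlgHom k R (Localization.Away t))
    (IsLocalization.injective _ hle)).trans (trdeg_le_one k)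

theorem finrank_tensorProduct_kaehlerDifferential_of_locally
    (h : RingHom.Locally (RingHom.IsStandardSmoothOfRelativeDimension 1) (algebraMap k R))
    (κ : Type u) [Field κ] [Algebra R κ] :
    Module.finrank κ (κ ⊗[R] KaehlerDifferential k R) = 1 := by
  have : (RingHom.ker (algebraMap R κ)).IsPrime := RingHom.ker_isPrime _
  obtain ⟨t, htq, ht⟩ := exists_away_isStandardSmooth h (RingHom.ker (algebraMap R κ))
  let f : Localization.Away t →+* κ := IsLocalization.Away.lift t (g := algebraMap R κ)
    (isUnit_iff_ne_zero.mpr htq)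
  let _ := f.toAlgebra
  have : IsScalarTower R (Localization.Away t) κ := .of_algebraMap_eq fun x =>
    (IsLocalization.Away.lift_eq t (isUnit_iff_ne_zero.mpr htq) x).symm
  have : Algebra.FormallyEtale R (Localization.Away t) :=
    .of_isLocalization (Submonoid.powers t)
  let e₁ := KaehlerDifferential.tensorKaehlerEquivOfFormallyEtale k R (Localization.Away t)
  let e₂ := (TensorProduct.AlgebraTensorModule.cancelBaseChange R (Localization.Away t) κ κ
    (KaehlerDifferential k R)).symm.trans
      (TensorProduct.AlgebraTensorModule.congr (LinearEquiv.refl κ κ) e₁)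
  rw [e₂.finrank_eq]
  exact finrank_tensorProduct_kaehlerDifferential k κ

end LocallyStandardSmooth

/-! ### Local rings and valuations of the curve -/

namespace Curve

variable {k : Type u} [Field k] (C : Curve k)

theorem constants_locally {U : C.scheme.Opens} (hU : IsAffineOpen U) :
    RingHom.Locally (RingHom.IsStandardSmoothOfRelativeDimension 1) (C.constants U) := by
  have h := HasRingHomProperty.appLE (P := @SmoothOfRelativeDimension 1) C.hom C.smooth
    ⟨⊤, isAffineOpen_top _⟩ ⟨U, hU⟩ le_top
  exact (RingHom.locally_respectsIso
    RingHom.isStandardSmoothOfRelativeDimension_respectsIso).2 _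
      (Scheme.ΓSpecIso (.of k)).symm.commRingCatIsoToRingEquiv h

theorem isPrincipal_maximalIdeal_stalk (x : C.scheme) :
    (IsLocalRing.maximalIdeal (C.scheme.presheaf.stalk x)).IsPrincipal := by
  obtain ⟨U, hU, hxU, -⟩ := exists_isAffineOpen_mem_and_subset (X := C.scheme) (x := x)
    (U := ⊤) trivial
  let _ : Algebra k Γ(C.scheme, U) := (C.constants U).toAlgebra
  let _ := C.scheme.presheaf.algebra_section_stalk ⟨x, hxU⟩
  let q := (hU.primeIdealOf ⟨x, hxU⟩).asIdeal
  have hl : IsLocalization.AtPrime (C.scheme.presheaf.stalk x) q :=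
    hU.isLocalization_stalk ⟨x, hxU⟩
  let e := (IsLocalization.algEquiv q.primeCompl (Localization.AtPrime q)
    (C.scheme.presheaf.stalk x)).toRingEquiv
  obtain ⟨a, ha⟩ := isPrincipal_maximalIdeal_localization_of_locally (k := k)
    (C.constants_locally hU) q
  rw [← IsLocalRing.map_ringEquiv_maximalIdeal e, ha]
  exact ⟨⟨_, (Ideal.map_span _ _).trans (by rw [Set.image_singleton])⟩⟩

/-- A Noetherian local domain with principal maximal ideal is a field or a discrete valuation ring,
and the coheight of a point is the dimension of its local ring. -/
theorem coheight_le_one (x : C.scheme) : Order.coheight x ≤ 1 := by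
  have hdim : ringKrullDim (C.scheme.presheaf.stalk x) ≤ 1 := by
    by_cases h : IsField (C.scheme.presheaf.stalk x)
    · exact (ringKrullDim_eq_zero_of_isField h).le.trans zero_le_one
    · have := ((IsDiscreteValuationRing.TFAE _ h).out 4 0).mp (C.isPrincipal_maximalIdeal_stalk x)
      have : IsDiscreteValuationRing (C.scheme.presheaf.stalk x) := this
      exact (IsPrincipalIdealRing.ringKrullDim_eq_one _ h).le
  rw [ringKrullDim_stalk_eq_coheight] at hdim
  exact_mod_cast hdim

theorem eq_genericPoint_or_coheight_eq_one (x : C.scheme) :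
    x = genericPoint C.scheme ∨ Order.coheight x = 1 := by
  rcases (C.coheight_le_one x).lt_or_eq with h | h
  · left
    rw [Order.lt_one_iff, Order.coheight_eq_zero] at h
    have h1 : genericPoint C.scheme ⤳ x := genericPoint_specializes x
    have h2 : x ⤳ genericPoint C.scheme := h h1
    exact (h2.antisymm h1).eq
  · exact .inr h

instance (p : C.ClosedPoint) : IsDiscreteValuationRing (C.scheme.presheaf.stalk p.1) := by
  have h : ¬IsField (C.scheme.presheaf.stalk p.1) := by
    intro h
    have := ringKrullDim_eq_zero_of_isField h
    rw [ringKrullDim_stalk_eq_coheight, p.2] at this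
    exact one_ne_zero (α := ℕ∞) (by exact_mod_cast this)
  exact ((IsDiscreteValuationRing.TFAE _ h).out 4 0).mp (C.isPrincipal_maximalIdeal_stalk p.1)

theorem closure_closedPoint (p : C.ClosedPoint) : closure {p.1} = {p.1} := by
  refine Set.Subset.antisymm (fun x hx => ?_) subset_closure
  have h : p.1 ⤳ x := specializes_iff_mem_closure.mpr hx
  by_contra hne
  have hlt : x < p.1 := lt_of_le_not_ge h fun h' => hne (Specializes.antisymm h' h).eq
  have h1 := Order.coheight_add_one_le hlt
  rw [p.2] at h1
  have h2 := h1.trans (C.coheight_le_one x)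
  exact absurd h2 (by decide)

variable {C} in
theorem mem_compl_iff {E : C.Divisor} {x : C.scheme} :
    x ∈ C.compl E ↔ ∀ p : C.ClosedPoint, p.1 = x → E p = 0 := by
  have hcl : closure (Subtype.val '' (E.support : Set C.ClosedPoint)) =
      Subtype.val '' (E.support : Set C.ClosedPoint) := by
    rw [← Set.biUnion_of_singleton (Subtype.val '' (E.support : Set C.ClosedPoint)),
      (E.support.finite_toSet.image _).closure_biUnion]
    refine Set.iUnion₂_congr ?_
    rintro _ ⟨p, -, rfl⟩
    exact C.closure_closedPoint p
  change x ∉ closure _ ↔ _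
  rw [hcl]
  constructor
  · intro h p hp
    by_contra h0
    exact h ⟨p, by simpa using h0, hp⟩
  · rintro h ⟨p, hp, rfl⟩
    exact (Finsupp.mem_support_iff.mp hp) (h p rfl)

section Valuation

variable {C} {p : C.ClosedPoint} {f g : C.FunctionField}

theorem ν_mul (hf : f ≠ 0) (hg : g ≠ 0) : C.ν p (f * g) = C.ν p f + C.ν p g :=
  Scheme.ord_mul hf hg

theorem ν_one : C.ν p 1 = 0 := by
  have := ν_mul (p := p) (one_ne_zero (α := C.FunctionField)) one_ne_zero
  rw [mul_one] at this
  linarith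

theorem ν_inv (hf : f ≠ 0) : C.ν p f⁻¹ = -C.ν p f := by
  have := ν_mul (p := p) hf (inv_ne_zero hf)
  rw [mul_inv_cancel₀ hf, ν_one] at this
  linarith

theorem min_ν_le_ν_add (h : f + g ≠ 0) : min (C.ν p f) (C.ν p g) ≤ C.ν p (f + g) :=
  Scheme.ord_add h

theorem ν_algebraMap_nonneg {a : C.scheme.presheaf.stalk p.1} (ha : a ≠ 0) :
    0 ≤ C.ν p (algebraMap _ C.FunctionField a) := by
  have ha' : algebraMap _ C.FunctionField a ≠ 0 := by simpa using ha
  refine (Scheme.le_ord_iff p.2 ha').mpr ?_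
  have : Ring.KrullDimLE 1 (C.scheme.presheaf.stalk p.1) := krullDimLE_of_coheight_le p.2.le
  exact Ring.ordFrac_ge_one_of_ne_zero ha

theorem exists_isUnit_of_ν_eq_zero (hf : f ≠ 0) (h : C.ν p f = 0) :
    ∃ a : C.scheme.presheaf.stalk p.1, IsUnit a ∧ algebraMap _ C.FunctionField a = f := by
  have h1 := (Scheme.ord_eq_iff p.2 hf).mp h
  have : Ring.KrullDimLE 1 (C.scheme.presheaf.stalk p.1) := krullDimLE_of_coheight_le p.2.le
  have h2 : f ∈ MonoidHom.mker (Ring.ordFrac (C.scheme.presheaf.stalk p.1)) := h1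
  rw [Ring.mker_ordFrac_eq_isUnitSubmonoid] at h2
  exact h2

theorem exists_algebraMap_eq_of_ν_nonneg (h : 0 ≤ C.ν p f) :
    ∃ a : C.scheme.presheaf.stalk p.1, algebraMap _ C.FunctionField a = f := by
  obtain rfl | hf := eq_or_ne f 0
  · exact ⟨0, map_zero _⟩
  obtain ⟨a, ha⟩ | ⟨a, ha⟩ := ValuationRing.isInteger_or_isInteger (C.scheme.presheaf.stalk p.1) f
  · exact ⟨a, ha⟩
  · have ha0 : a ≠ 0 := by
      rintro rfl
      exact inv_ne_zero hf (ha.symm.trans (map_zero _))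
    have h1 := ν_algebraMap_nonneg ha0
    rw [ha, ν_inv hf] at h1
    obtain ⟨b, -, hb⟩ := exists_isUnit_of_ν_eq_zero hf (le_antisymm (by linarith) h)
    exact ⟨b, hb⟩

theorem isUnit_iff_ν_eq_zero {a : C.scheme.presheaf.stalk p.1} (ha : a ≠ 0) :
    IsUnit a ↔ C.ν p (algebraMap _ C.FunctionField a) = 0 := by
  have h0 : algebraMap _ C.FunctionField a ≠ 0 := by simpa using ha
  have : Ring.KrullDimLE 1 (C.scheme.presheaf.stalk p.1) := krullDimLE_of_coheight_le p.2.le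
  rw [Ring.isUnit_iff_ordFrac_one_of_isDiscreteValuationRing (K := C.FunctionField)]
  exact (Scheme.ord_eq_iff p.2 h0).symm

end Valuation

end Curve

/-! ### Morphisms to `Proj` read in standard charts -/

section ProjChart

open HomogeneousLocalization

variable {A σ : Type u} [CommRing A] [SetLike σ A] [AddSubgroupClass σ A] (𝒜 : ℕ → σ)
  [GradedRing 𝒜] {X : Scheme.{u}} (φ : X ⟶ Proj 𝒜)

/-- The map `F / f ^ n ↦ φ^* (F / f ^ n)` from functions on the chart `f ≠ 0` of `Proj 𝒜` to the
stalk of `X` at a point mapped into this chart. -/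
def chartMap (f : A) (x : X) (hx : x ∈ φ ⁻¹ᵁ Proj.basicOpen 𝒜 f) :
    Away 𝒜 f →+* X.presheaf.stalk x :=
  (Proj.awayToSection 𝒜 f ≫ φ.app (Proj.basicOpen 𝒜 f) ≫
    X.presheaf.germ (φ ⁻¹ᵁ Proj.basicOpen 𝒜 f) x hx).hom

theorem chartMap_awayMap {f g fg : A} {d : ℕ} (hg : g ∈ 𝒜 d) (hfg : fg = f * g) (x : X)
    (hx : x ∈ φ ⁻¹ᵁ Proj.basicOpen 𝒜 f) (hx' : x ∈ φ ⁻¹ᵁ Proj.basicOpen 𝒜 fg) (a : Away 𝒜 f) :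
    chartMap 𝒜 φ fg x hx' (awayMap 𝒜 hg hfg a) = chartMap 𝒜 φ f x hx a := by
  have h : CommRingCat.ofHom (awayMap 𝒜 hg hfg) ≫ Proj.awayToSection 𝒜 fg ≫
      φ.app (Proj.basicOpen 𝒜 fg) ≫ X.presheaf.germ (φ ⁻¹ᵁ Proj.basicOpen 𝒜 fg) x hx' =
      Proj.awayToSection 𝒜 f ≫ φ.app (Proj.basicOpen 𝒜 f) ≫
        X.presheaf.germ (φ ⁻¹ᵁ Proj.basicOpen 𝒜 f) x hx := by
    rw [← Category.assoc, Proj.awayMap_awayToSection, Category.assoc,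
      Scheme.Hom.naturality_assoc, TopCat.Presheaf.germ_res]
  exact congr($h a)

theorem stalkSpecializes_chartMap (f : A) {x y : X} (h : x ⤳ y)
    (hx : x ∈ φ ⁻¹ᵁ Proj.basicOpen 𝒜 f) (hy : y ∈ φ ⁻¹ᵁ Proj.basicOpen 𝒜 f) (a : Away 𝒜 f) :
    X.presheaf.stalkSpecializes h (chartMap 𝒜 φ f y hy a) = chartMap 𝒜 φ f x hx a := by
  have h : (Proj.awayToSection 𝒜 f ≫ φ.app (Proj.basicOpen 𝒜 f) ≫
      X.presheaf.germ (φ ⁻¹ᵁ Proj.basicOpen 𝒜 f) y hy) ≫ X.presheaf.stalkSpecializes h =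
      Proj.awayToSection 𝒜 f ≫ φ.app (Proj.basicOpen 𝒜 f) ≫
        X.presheaf.germ (φ ⁻¹ᵁ Proj.basicOpen 𝒜 f) x hx := by
    simp only [Category.assoc, TopCat.Presheaf.germ_stalkSpecializes]
  exact congr($h a)

theorem SpecMap_chartMap_awayι {f : A} {d : ℕ} (hf : f ∈ 𝒜 d) (hd : 0 < d) (x : X)
    (hx : x ∈ φ ⁻¹ᵁ Proj.basicOpen 𝒜 f) :
    Spec.map (CommRingCat.ofHom (chartMap 𝒜 φ f x hx)) ≫ Proj.awayι 𝒜 f hf hd =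
      X.fromSpecStalk x ≫ φ := by
  change Spec.map (Proj.awayToSection 𝒜 f ≫ φ.app (Proj.basicOpen 𝒜 f) ≫
    X.presheaf.germ (φ ⁻¹ᵁ Proj.basicOpen 𝒜 f) x hx) ≫ _ = _
  have h : (Proj.basicOpen 𝒜 f).toSpecΓ ≫ Spec.map (Proj.awayToSection 𝒜 f) ≫
      Proj.awayι 𝒜 f hf hd = (Proj.basicOpen 𝒜 f).ι := by
    rw [← Category.assoc, Proj.awayι, ← Category.assoc,
      show (Proj.basicOpen 𝒜 f).toSpecΓ ≫ Spec.map (Proj.awayToSection 𝒜 f) =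
        (Proj.basicOpenIsoSpec 𝒜 f hf hd).hom from rfl, Iso.hom_inv_id, Category.id_comp]
  rw [Spec.map_comp, Spec.map_comp, Category.assoc, Category.assoc,
    ← Scheme.Opens.fromSpecStalkOfMem_toSpecΓ, Category.assoc,
    Scheme.Opens.toSpecΓ_naturality_assoc, h, morphismRestrict_ι,
    Scheme.Opens.fromSpecStalkOfMem_ι_assoc]

/-- Inside the chart `f ≠ 0`, the locus `g ≠ 0` is where the function `g / f` is invertible. Pulling
it back to the stalk, invertibility means avoiding the maximal ideal. -/
theorem mem_basicOpen_iff_isUnit_chartMap {f g : A} (hf : f ∈ 𝒜 1) (hg : g ∈ 𝒜 1) (x : X)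
    (hx : x ∈ φ ⁻¹ᵁ Proj.basicOpen 𝒜 f) :
    φ x ∈ Proj.basicOpen 𝒜 g ↔
      IsUnit (chartMap 𝒜 φ f x hx (Away.mk 𝒜 hf 1 g (by simpa using hg))) := by
  let y : Spec (.of (Away 𝒜 f)) :=
    PrimeSpectrum.comap (chartMap 𝒜 φ f x hx) (IsLocalRing.closedPoint (X.presheaf.stalk x))
  have h1 : Proj.awayι 𝒜 f hf one_pos y = φ x := by
    have := congr($(SpecMap_chartMap_awayι 𝒜 φ hf one_pos x hx)
      (IsLocalRing.closedPoint (X.presheaf.stalk x)))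
    exact this.trans congr(φ $(X.fromSpecStalk_closedPoint))
  have h2 := Proj.awayι_preimage_basicOpen 𝒜 hf one_pos hg one_pos
  have h3 : Away.isLocalizationElem hf hg = Away.mk 𝒜 hf 1 g (by simpa using hg) := by
    ext
    simp [Away.isLocalizationElem]
  have h4 : y ∈ Proj.awayι 𝒜 f hf one_pos ⁻¹ᵁ Proj.basicOpen 𝒜 g ↔
      Away.isLocalizationElem hf hg ∉ y.asIdeal := by
    rw [h2]
    rfl
  rw [← h1, ← h3]
  refine h4.trans ?_
  change ¬(chartMap 𝒜 φ f x hx _ ∈ IsLocalRing.maximalIdeal _) ↔ _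
  rw [IsLocalRing.mem_maximalIdeal, mem_nonunits_iff, not_not]

variable {A σ : Type u} [CommRing A] [SetLike σ A] [AddSubgroupClass σ A] (𝒜 : ℕ → σ)
  [GradedRing 𝒜] {X : Scheme.{u}} (φ : X ⟶ Proj 𝒜)

theorem range_germ_eq_range_chartMap [IsClosedImmersion φ] {f : A} {d : ℕ} (hf : f ∈ 𝒜 d)
    (hd : 0 < d) (x : X) {U : X.Opens} (hU : U = φ ⁻¹ᵁ Proj.basicOpen 𝒜 f) (hx : x ∈ U) :
    Set.range (X.presheaf.germ U x hx) = Set.range (chartMap 𝒜 φ f x (hU ▸ hx)) := by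
  subst hU
  have h1 : Function.Surjective (φ.app (Proj.basicOpen 𝒜 f)) :=
    φ.app_surjective _ (Proj.isAffineOpen_basicOpen 𝒜 f hf hd)
  have h2 : Function.Surjective (Proj.awayToSection 𝒜 f) :=
    (Proj.basicOpenIsoAway 𝒜 f hf hd).commRingCatIsoToRingEquiv.surjective
  exact ((h1.comp h2).range_comp _).symm

theorem chartMap_eq_of_SpecMap {f : A} {d : ℕ} (hf : f ∈ 𝒜 d) (hd : 0 < d) (x : X)
    (ψ : Away 𝒜 f →+* X.presheaf.stalk x)
    (hψ : X.fromSpecStalk x ≫ φ =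
      Spec.map (CommRingCat.ofHom ψ) ≫ Proj.awayι 𝒜 f hf hd) :
    ∃ hx : x ∈ φ ⁻¹ᵁ Proj.basicOpen 𝒜 f, chartMap 𝒜 φ f x hx = ψ := by
  have hx : x ∈ φ ⁻¹ᵁ Proj.basicOpen 𝒜 f := by
    change φ x ∈ Proj.basicOpen 𝒜 f
    rw [← Proj.opensRange_awayι 𝒜 f hf hd]
    have := congr($hψ (IsLocalRing.closedPoint (X.presheaf.stalk x)))
    exact ⟨_, this.symm.trans congr(φ $(X.fromSpecStalk_closedPoint))⟩
  refine ⟨hx, ?_⟩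
  rw [← SpecMap_chartMap_awayι 𝒜 φ hf hd x hx, cancel_mono] at hψ
  exact congr(($(Spec.map_injective hψ)).hom)

/-- The value of `F / g ^ n` in terms of the chart `f ≠ 0`. -/
theorem chartMap_mul_pow {f g : A} (hf : f ∈ 𝒜 1) (hg : g ∈ 𝒜 1) (x : X)
    (hxf : x ∈ φ ⁻¹ᵁ Proj.basicOpen 𝒜 f) (hxg : x ∈ φ ⁻¹ᵁ Proj.basicOpen 𝒜 g) (n : ℕ) (F : A)
    (hF : F ∈ 𝒜 (n • 1)) :
    chartMap 𝒜 φ g x hxg (Away.mk 𝒜 hg n F hF) *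
      chartMap 𝒜 φ f x hxf (Away.mk 𝒜 hf 1 g (by simpa using hg)) ^ n =
    chartMap 𝒜 φ f x hxf (Away.mk 𝒜 hf n F hF) := by
  have hx : x ∈ φ ⁻¹ᵁ Proj.basicOpen 𝒜 (f * g) := by
    rw [Proj.basicOpen_mul]
    exact ⟨hxf, hxg⟩
  rw [← chartMap_awayMap 𝒜 φ hg rfl x hxf hx, ← chartMap_awayMap 𝒜 φ hg rfl x hxf hx,
    ← chartMap_awayMap 𝒜 φ hf (mul_comm f g) x hxg hx, ← map_pow, ← map_mul]
  congr 1
  ext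
  simp only [awayMap_mk, val_mul, val_pow, Away.val_mk, Localization.mk_pow, Localization.mk_mul]
  rw [Localization.mk_eq_mk_iff, Localization.r_iff_exists]
  exact ⟨1, by simp; ring⟩

end ProjChart

namespace Curve

variable {k : Type u} [Field k] (C : Curve k)

instance (E : C.Divisor) : IsScalarTower k (C.RegularFunctions E) C.FunctionField := by
  refine .of_algebraMap_eq' ?_
  have h : C.hom.appLE ⊤ ⊤ le_top ≫ C.scheme.presheaf.germ ⊤ (genericPoint C.scheme) trivial =
      C.hom.appLE ⊤ (C.compl E) le_top ≫
        C.scheme.presheaf.germ (C.compl E) (genericPoint C.scheme) (C.genericPoint_mem_compl E) := by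
    have h1 : C.hom.appLE ⊤ (C.compl E) le_top =
        C.hom.appLE ⊤ ⊤ le_top ≫ C.scheme.presheaf.map (homOfLE le_top).op :=
      (Scheme.Hom.appLE_map C.hom _ (homOfLE le_top).op).symm
    rw [h1, Category.assoc, TopCat.Presheaf.germ_res]
  ext a
  exact congr($h _)

variable {C} in
theorem one_mem_H0 {E : C.Divisor} (hE : 0 ≤ E) : (1 : C.FunctionField) ∈ C.H0 E :=
  .inr fun p => by
    rw [ν_one]
    exact neg_nonpos.mpr (hE p)

end Curve

/-! ### Complements of very ample divisors -/

section VeryAmple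

attribute [local instance] MvPolynomial.gradedAlgebra

open HomogeneousLocalization

variable {k : Type u} [Field k]

theorem exists_mem_basicOpen_X {n : ℕ} (x : ProjSpace k n) :
    ∃ i, x ∈ Proj.basicOpen (MvPolynomial.homogeneousSubmodule (Fin (n + 1)) k)
      (MvPolynomial.X i) := by
  have h := Proj.iSup_basicOpen_eq_top' (MvPolynomial.homogeneousSubmodule (Fin (n + 1)) k)
    MvPolynomial.X (fun i => ⟨1, MvPolynomial.isHomogeneous_X k i⟩) (by
      refine top_le_iff.mp fun p _ => ?_
      induction p using MvPolynomial.induction_on with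
      | C a =>
        exact Subalgebra.algebraMap_mem _
          (⟨MvPolynomial.C a, MvPolynomial.isHomogeneous_C _ a⟩ :
            MvPolynomial.homogeneousSubmodule (Fin (n + 1)) k 0)
      | add p q hp hq => exact add_mem (hp trivial) (hq trivial)
      | mul_X p i hp => exact mul_mem (hp trivial) (Algebra.subset_adjoin ⟨i, rfl⟩))
  exact TopologicalSpace.Opens.mem_iSup.mp (h ▸ TopologicalSpace.Opens.mem_top x)

variable {C : Curve k} {n : ℕ} {φ : C.scheme ⟶ ProjSpace k n} {s : Fin (n + 1) → C.FunctionField}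

theorem Curve.IsGivenBy.chartMap_eq (h : C.IsGivenBy φ s) (i : Fin (n + 1)) :
    ∃ hx : genericPoint C.scheme ∈ φ ⁻¹ᵁ Proj.basicOpen _ (MvPolynomial.X i),
      ∀ (d : ℕ) (F : MvPolynomial (Fin (n + 1)) k)
        (hF : F ∈ MvPolynomial.homogeneousSubmodule (Fin (n + 1)) k (d • 1)),
        (chartMap _ φ (MvPolynomial.X i) _ hx
          (Away.mk _ (MvPolynomial.isHomogeneous_X k i) d F hF) : C.FunctionField) =
        MvPolynomial.aeval s F / s i ^ d := by
  obtain ⟨ψ, hψ, hF⟩ := h i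
  obtain ⟨hx, h⟩ := chartMap_eq_of_SpecMap _ φ _ one_pos _ ψ hψ
  exact ⟨hx, fun d F hF' => by rw [h, hF]⟩

theorem Curve.IsGivenBy.algebraMap_chartMap (h : C.IsGivenBy φ s) (i : Fin (n + 1))
    (x : C.scheme) (hx : x ∈ φ ⁻¹ᵁ Proj.basicOpen _ (MvPolynomial.X i)) (d : ℕ)
    (F : MvPolynomial (Fin (n + 1)) k)
    (hF : F ∈ MvPolynomial.homogeneousSubmodule (Fin (n + 1)) k (d • 1)) :
    algebraMap _ C.FunctionField (chartMap _ φ (MvPolynomial.X i) x hx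
      (Away.mk _ (MvPolynomial.isHomogeneous_X k i) d F hF)) =
    MvPolynomial.aeval s F / s i ^ d := by
  obtain ⟨hη, h⟩ := h.chartMap_eq i
  rw [← h]
  exact stalkSpecializes_chartMap _ φ _ (genericPoint_specializes x) hη hx _

/-- A hyperplane section: for a very ample effective divisor `E`, the complement of `E` is the
preimage of the complement of the hyperplane given by the section `1` of `𝒪(E)`. -/
theorem Curve.IsGivenBy.compl_eq (h : C.IsGivenBy φ s) {E : C.Divisor}
    (hs0 : ∀ i, s i ≠ 0) (hs : ∀ i, s i ∈ C.H0 E)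
    (hbp : ∀ p, ∃ j, C.ν p (s j) = -E p) {ℓ : MvPolynomial (Fin (n + 1)) k}
    (hℓ : ℓ ∈ MvPolynomial.homogeneousSubmodule (Fin (n + 1)) k 1)
    (hℓs : MvPolynomial.aeval s ℓ = 1) :
    C.compl E = φ ⁻¹ᵁ Proj.basicOpen _ ℓ := by
  ext x
  obtain ⟨i, hi⟩ := exists_mem_basicOpen_X (φ x)
  have hi : x ∈ φ ⁻¹ᵁ Proj.basicOpen _ (MvPolynomial.X i) := hi
  refine Iff.trans ?_ (mem_basicOpen_iff_isUnit_chartMap _ φ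
    (MvPolynomial.isHomogeneous_X k i) hℓ x hi).symm
  have hv := h.algebraMap_chartMap i x hi 1 ℓ (by simpa using hℓ)
  rw [hℓs, pow_one] at hv
  set a := chartMap _ φ (MvPolynomial.X i) x hi
    (Away.mk _ (MvPolynomial.isHomogeneous_X k i) 1 ℓ (by simpa using hℓ))
  have ha : a ≠ 0 := by
    intro ha
    rw [ha, map_zero] at hv
    exact one_div_ne_zero (hs0 i) hv.symm
  rcases C.eq_genericPoint_or_coheight_eq_one x with rfl | hx
  · refine iff_of_true (C.genericPoint_mem_compl E) ?_
    exact isUnit_iff_ne_zero (G₀ := C.FunctionField).mpr ha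
  · let p : C.ClosedPoint := ⟨x, hx⟩
    -- On the chart `X_i ≠ 0` all ratios `s j / s i` are regular at `p`. Taking the `j` that attains
    -- the maximal pole order allowed by `E` shows that `s i` attains it too.
    have hνi : C.ν p (s i) = -E p := by
      refine le_antisymm ?_ ((hs i).resolve_left (hs0 i) p)
      obtain ⟨j, hj⟩ := hbp p
      have hb := h.algebraMap_chartMap i x hi 1 (MvPolynomial.X j)
        (by simpa using MvPolynomial.isHomogeneous_X k j)
      set b := chartMap _ φ (MvPolynomial.X i) x hi (Away.mk _ (MvPolynomial.isHomogeneous_X k i) 1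
        (MvPolynomial.X j) (by simpa using MvPolynomial.isHomogeneous_X k j))
      rw [MvPolynomial.aeval_X, pow_one, div_eq_mul_inv] at hb
      have hb0 : b ≠ 0 := by
        intro h0
        rw [h0, map_zero] at hb
        exact mul_ne_zero (hs0 j) (inv_ne_zero (hs0 i)) hb.symm
      have := ν_algebraMap_nonneg (p := p) hb0
      rw [hb, ν_mul (hs0 j) (inv_ne_zero (hs0 i)), ν_inv (hs0 i), hj] at this
      linarith
    have hu : IsUnit a ↔ C.ν p (algebraMap _ C.FunctionField a) = 0 :=
      isUnit_iff_ν_eq_zero (p := p) ha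
    -- `ℓ / X_i` pulls back to `1 / s i`, of valuation `E p`, so it is a unit exactly when `p` is
    -- not in the support of `E`.
    rw [hu, hv, one_div, ν_inv (hs0 i), hνi, neg_neg]
    refine mem_compl_iff.trans ⟨fun H => H p rfl, ?_⟩
    rintro H q hq
    rwa [show q = p from Subtype.ext hq]

/-- The section 1 is a linear form `ℓ` in the basis, so the complement of `E` is closed in the
affine chart `ℓ ≠ 0`. Regular functions on it lift to fractions `F / ℓ ^ d`, which become
polynomials in the basis since `ℓ` has value 1. -/
theorem Curve.IsVeryAmple.isAffineOpen_compl_and_range {E : C.Divisor} (hE : 0 ≤ E)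
    (h : C.IsVeryAmple E) :
    IsAffineOpen (C.compl E) ∧
      (IsScalarTower.toAlgHom k (C.RegularFunctions E) C.FunctionField).range =
        Algebra.adjoin k (C.H0 E) := by
  obtain ⟨n, s, hind, hspan, hbp, φ, hφ, hφs⟩ := h
  have h1 : (1 : C.FunctionField) ∈ Submodule.span k (Set.range s) := by
    rw [← SetLike.mem_coe, hspan]
    exact one_mem_H0 hE
  obtain ⟨c, hc⟩ := (Submodule.mem_span_range_iff_exists_fun k).mp h1
  let ℓ : MvPolynomial (Fin (n + 1)) k := ∑ i, c i • MvPolynomial.X i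
  have hℓ : ℓ ∈ MvPolynomial.homogeneousSubmodule (Fin (n + 1)) k 1 :=
    Submodule.sum_mem _ fun i _ => Submodule.smul_mem _ _ (MvPolynomial.isHomogeneous_X k i)
  have hℓs : MvPolynomial.aeval s ℓ = 1 := by simp [ℓ, hc]
  have hsm : ∀ i, s i ∈ C.H0 E := fun i => hspan ▸ Submodule.subset_span ⟨i, rfl⟩
  have hcompl := hφs.compl_eq hind.ne_zero hsm hbp hℓ hℓs
  refine ⟨?_, ?_⟩
  · rw [hcompl]
    exact (Proj.isAffineOpen_basicOpen _ ℓ hℓ one_pos).preimage φ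
  have hη : genericPoint C.scheme ∈ φ ⁻¹ᵁ Proj.basicOpen _ ℓ :=
    hcompl ▸ C.genericPoint_mem_compl E
  have hrange := range_germ_eq_range_chartMap _ φ hℓ one_pos _ hcompl
    (C.genericPoint_mem_compl E)
  have hval : ∀ (d : ℕ) (F : MvPolynomial (Fin (n + 1)) k)
      (hF : F ∈ MvPolynomial.homogeneousSubmodule (Fin (n + 1)) k (d • 1)),
      (chartMap _ φ ℓ _ hη (Away.mk _ hℓ d F hF) : C.FunctionField) = MvPolynomial.aeval s F := by
    intro d F hF
    -- `IsGivenBy` only describes the coordinate charts; the value on `ℓ ≠ 0` is obtained by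
    -- comparison with the chart `X₀ ≠ 0` at the generic point.
    obtain ⟨hη₀, H⟩ := hφs.chartMap_eq 0
    have := chartMap_mul_pow _ φ (MvPolynomial.isHomogeneous_X k 0) hℓ _ hη₀ hη d F hF
    rw [H, H, hℓs, pow_one, one_div, inv_pow, div_eq_mul_inv] at this
    exact mul_right_cancel₀ (inv_ne_zero (pow_ne_zero d (hind.ne_zero 0))) this
  refine le_antisymm ?_ ?_
  · rintro _ ⟨r, rfl⟩
    have : C.toRational E r ∈ Set.range (chartMap _ φ ℓ _ hη) := hrange ▸ ⟨r, rfl⟩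
    obtain ⟨a, ha⟩ := this
    obtain ⟨d, F, hF, rfl⟩ := Away.mk_surjective _ hℓ a
    rw [hval] at ha
    change C.toRational E r ∈ _
    rw [← ha]
    have hsub : Set.range s ⊆ C.H0 E := by
      rintro _ ⟨i, rfl⟩
      exact hsm i
    refine Algebra.adjoin_mono hsub ?_
    rw [Algebra.adjoin_range_eq_range_aeval]
    exact ⟨F, rfl⟩
  · have hle : Submodule.span k (Set.range s) ≤ Subalgebra.toSubmodule
        (IsScalarTower.toAlgHom k (C.RegularFunctions E) C.FunctionField).range := by
      refine Submodule.span_le.mpr ?_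
      rintro _ ⟨i, rfl⟩
      have h2 := hval 1 (MvPolynomial.X i) (by simpa using MvPolynomial.isHomogeneous_X k i)
      rw [MvPolynomial.aeval_X] at h2
      have : s i ∈ Set.range (C.scheme.presheaf.germ (C.compl E) _ (C.genericPoint_mem_compl E)) :=
        hrange ▸ ⟨_, h2⟩
      exact this
    exact Algebra.adjoin_le fun x hx => hle (SetLike.mem_coe.mp (hspan ▸ hx))

end VeryAmple

/-- An inclusion of affine opens is an open immersion, hence a monomorphism, so restriction of
functions is an epimorphism of rings even when it is not surjective. -/
theorem restriction_hom_ext {X : Scheme.{u}} {U V : X.Opens} (hU : IsAffineOpen U)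
    (hV : IsAffineOpen V) (h : U ≤ V) {T : Type u} [CommRing T] {x y : Γ(X, U) →+* T}
    (hxy : x.comp (X.presheaf.map (homOfLE h).op).hom =
      y.comp (X.presheaf.map (homOfLE h).op).hom) : x = y := by
  have h1 := hV.map_fromSpec hU (homOfLE h).op
  have : Spec.map (CommRingCat.ofHom x) = Spec.map (CommRingCat.ofHom y) := by
    rw [← cancel_mono hU.fromSpec, ← h1, ← Spec.map_comp_assoc, ← Spec.map_comp_assoc]
    congr 2
    ext a
    exact congr($hxy a)
  exact congr(($(Spec.map_injective this)).hom)

/-! ### Disjointness of critical values on the curve -/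

namespace Curve

variable {k : Type u} [Field k] {C : Curve k} {E E₀ : C.Divisor}

theorem compl_le_compl (hE₀ : 0 ≤ E₀) (h : 3 • E₀ ≤ E) : C.compl E ≤ C.compl E₀ := by
  intro x hx
  refine mem_compl_iff.mpr fun p hp => ?_
  have h1 := mem_compl_iff.mp hx p hp
  have h2 : 3 * E₀ p ≤ E p := by simpa using h p
  have h3 : 0 ≤ E₀ p := hE₀ p
  linarith

theorem toRational_injective (E : C.Divisor) : Function.Injective (C.toRational E) :=
  C.scheme.germToFunctionField_injective (C.compl E)

theorem IsVeryAmple.algebraMap_mem_H0 (hE : C.IsVeryAmple E) (hE0 : 0 ≤ E) (c : k) :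
    algebraMap k C.FunctionField c ∈ C.H0 E := by
  obtain ⟨n, s, -, hspan, -⟩ := hE
  rw [← hspan, Algebra.algebraMap_eq_smul_one]
  exact Submodule.smul_mem _ c (hspan ▸ one_mem_H0 hE0 : (1 : C.FunctionField) ∈ (_ : Set _))

/-- This is how H⁰(E₀) separates points and tangent vectors on the complement of `E`. It generates
the functions on the larger complement of `E₀`, and homomorphisms out of the functions on the
smaller open are determined by restriction from there. -/
theorem ringHom_ext_of_eqOn_H0 (hE : C.IsVeryAmple E) (hE0 : 0 ≤ E) (hE₀ : C.IsVeryAmple E₀)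
    (hE₀0 : 0 ≤ E₀) (h : 3 • E₀ ≤ E) {T : Type u} [CommRing T]
    {x y : C.RegularFunctions E →+* T}
    (hxy : Set.EqOn x y {w | C.toRational E w ∈ C.H0 E₀}) : x = y := by
  obtain ⟨hU, -⟩ := hE.isAffineOpen_compl_and_range hE0
  obtain ⟨hV, hr⟩ := hE₀.isAffineOpen_compl_and_range hE₀0
  have hle := compl_le_compl hE₀0 h
  have hres : ∀ r, C.toRational E (C.scheme.presheaf.map (homOfLE hle).op r) =
      C.toRational E₀ r := fun r =>
    TopCat.Presheaf.germ_res_apply _ (homOfLE hle) _ (C.genericPoint_mem_compl E) r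
  have key : ∀ f ∈ Algebra.adjoin k (C.H0 E₀), ∃ w, C.toRational E w = f ∧ x w = y w := by
    intro f hf
    have hH : ∀ f ∈ C.H0 E₀, ∃ w, C.toRational E w = f ∧ x w = y w := by
      intro f hf
      obtain ⟨r, hr'⟩ : f ∈ (IsScalarTower.toAlgHom k (C.RegularFunctions E₀)
        C.FunctionField).range := hr ▸ Algebra.subset_adjoin hf
      have hr'' : C.toRational E₀ r = f := hr'
      refine ⟨C.scheme.presheaf.map (homOfLE hle).op r, (hres r).trans hr'', hxy ?_⟩
      change C.toRational E _ ∈ C.H0 E₀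
      rw [hres, hr'']
      exact hf
    induction hf using Algebra.adjoin_induction with
    | mem f hf => exact hH f hf
    | algebraMap c => exact hH _ (hE₀.algebraMap_mem_H0 hE₀0 c)
    | add f g _ _ hf hg =>
      obtain ⟨a, rfl, ha⟩ := hf
      obtain ⟨b, rfl, hb⟩ := hg
      exact ⟨a + b, map_add _ _ _, by rw [map_add, map_add, ha, hb]⟩
    | mul f g _ _ hf hg =>
      obtain ⟨a, rfl, ha⟩ := hf
      obtain ⟨b, rfl, hb⟩ := hg
      exact ⟨a * b, map_mul _ _ _, by rw [map_mul, map_mul, ha, hb]⟩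
  refine restriction_hom_ext hU hV hle (RingHom.ext fun r => ?_)
  have hmem : C.toRational E₀ r ∈ Algebra.adjoin k (C.H0 E₀) := hr ▸ ⟨r, rfl⟩
  obtain ⟨w, hw, hxw⟩ := key _ hmem
  have : C.scheme.presheaf.map (homOfLE hle).op r = w :=
    toRational_injective E ((hres r).trans hw.symm)
  change x (C.scheme.presheaf.map (homOfLE hle).op r) = y (C.scheme.presheaf.map (homOfLE hle).op r)
  rw [this, hxw]

theorem mul_mul_mem_H0 (h : 3 • E₀ ≤ E) {f₁ f₂ f₃ : C.FunctionField} (h₁ : f₁ ∈ C.H0 E₀)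
    (h₂ : f₂ ∈ C.H0 E₀) (h₃ : f₃ ∈ C.H0 E₀) : f₁ * f₂ * f₃ ∈ C.H0 E := by
  rcases h₁ with rfl | h₁
  · simp [H0]
  rcases h₂ with rfl | h₂
  · simp [H0]
  rcases h₃ with rfl | h₃
  · simp [H0]
  by_cases h0 : f₁ * f₂ * f₃ = 0
  · exact .inl h0
  refine .inr fun p => ?_
  have h4 : 3 * E₀ p ≤ E p := by simpa using h p
  simp only [mul_eq_zero, not_or] at h0
  rw [ν_mul (mul_ne_zero h0.1.1 h0.1.2) h0.2, ν_mul h0.1.1 h0.1.2]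
  linarith [h₁ p, h₂ p, h₃ p]

theorem mem_span_of_toRational_mem_H0 {m : ℕ} {g : Fin m → C.RegularFunctions E}
    (hg : (Submodule.span k (Set.range (Fin.cons 1 (fun j => C.toRational E (g j)) :
      Fin (m + 1) → C.FunctionField)) : Set C.FunctionField) = C.H0 E)
    {r : C.RegularFunctions E} (hr : C.toRational E r ∈ C.H0 E) :
    r ∈ Submodule.span k (insert 1 (Set.range g)) := by
  let τ := (IsScalarTower.toAlgHom k (C.RegularFunctions E) C.FunctionField).toLinearMap
  have h1 : Set.range (Fin.cons 1 (fun j => C.toRational E (g j)) :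
      Fin (m + 1) → C.FunctionField) = τ '' insert 1 (Set.range g) := by
    rw [Fin.range_cons, Set.image_insert_eq, ← Set.range_comp]
    congr 1
    exact (map_one (algebraMap (C.RegularFunctions E) C.FunctionField)).symm
  rw [← hg, h1, Submodule.span_image] at hr
  obtain ⟨r', hr', h⟩ := hr
  rwa [← toRational_injective E h]

theorem IsVeryAmple.constants_locally (hE : C.IsVeryAmple E) (hE0 : 0 ≤ E) :
    RingHom.Locally (RingHom.IsStandardSmoothOfRelativeDimension 1)
      (algebraMap k (C.RegularFunctions E)) :=
  C.constants_locally (hE.isAffineOpen_compl_and_range hE0).1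

theorem not_exists_common_critical_value (hE0 : 0 ≤ E) (hE : C.IsVeryAmple E)
    (hE₀0 : 0 ≤ E₀) (hE₀ : C.IsVeryAmple E₀) (h : 3 • E₀ ≤ E)
    (f₀ σ₁ σ₂ : C.RegularFunctions E) (hσ : σ₁ ≠ σ₂) {m : ℕ} (g : Fin m → C.RegularFunctions E)
    (hg : (Submodule.span k (Set.range (Fin.cons 1 (fun j => C.toRational E (g j)) :
      Fin (m + 1) → C.FunctionField)) : Set C.FunctionField) = C.H0 E) :
    ¬ ∃ x y : PrimeSpectrum (FieldA' k m ⊗[k] C.RegularFunctions E),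
      DiffVanishesAt (FieldA' k m) (psi k σ₁ f₀ g) x ∧
      DiffVanishesAt (FieldA' k m) (psi k σ₂ f₀ g) y ∧
      valueAt (FieldA' k m) (psi k σ₁ f₀ g) x =
        valueAt (FieldA' k m) (psi k σ₂ f₀ g) y := by
  have hloc := hE.constants_locally hE0
  refine ShortInterval.not_exists_common_critical_value (trdeg_le_one_of_locally hloc) (fun q => ?_)
    {w | C.toRational E w ∈ C.H0 E₀} ?_ ?_ g ?_ f₀ σ₁ σ₂ hσ
  · refine Module.nontrivial_of_finrank_pos (R := q.asIdeal.ResidueField) ?_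
    rw [finrank_tensorProduct_kaehlerDifferential_of_locally hloc]
    exact one_pos
  · change algebraMap (C.RegularFunctions E) C.FunctionField 1 ∈ C.H0 E₀
    rw [map_one]
    exact one_mem_H0 hE₀0
  · intro T _ x y hxy
    exact ringHom_ext_of_eqOn_H0 hE hE0 hE₀ hE₀0 h hxy
  · intro w₁ h₁ w₂ h₂ w₃ h₃
    refine mem_span_of_toRational_mem_H0 hg ?_
    change algebraMap (C.RegularFunctions E) C.FunctionField _ ∈ C.H0 E
    rw [map_mul, map_mul]
    exact mul_mul_mem_H0 h h₁ h₂ h₃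

end Curve

/-! ### Integrality by valuation rings -/

section IntegralityCriterion

/-- The integral closure in a field is the intersection of the valuation rings containing it. -/
theorem isIntegral_of_forall_valuationSubring {A S F : Type*} [CommRing A] [CommRing S] [Field F]
    [Algebra A S] [Algebra S F] [FaithfulSMul S F] {s : S}
    (h : ∀ V : ValuationSubring F, (∀ a : A, algebraMap S F (algebraMap A S a) ∈ V) →
      algebraMap S F s ∈ V) : _root_.IsIntegral A s := by
  let _ : Algebra A F := ((algebraMap S F).comp (algebraMap A S)).toAlgebra
  have : IsScalarTower A S F := .of_algebraMap_eq' rfl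
  rw [← isIntegral_algebraMap_iff (FaithfulSMul.algebraMap_injective S F)]
  let B : Subring F := (integralClosure A F).toSubring
  have hB : IsIntegrallyClosedIn B F :=
    inferInstanceAs (IsIntegrallyClosedIn (integralClosure A F).toSubring F)
  suffices algebraMap S F s ∈ B from this
  rw [Subring.eq_iInf_of_isIntegrallyClosedIn (R := B), Subring.mem_iInf]
  exact fun V => h V.1 fun a => V.2 (isIntegral_algebraMap (R := A) (A := F))

/-- The ring is a localization of the polynomial ring `R[A₁, …, Aₘ]`. -/
instance isDomain_fieldA'_tensorProduct (k : Type u) [Field k] (m : ℕ) (R : Type u) [CommRing R]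
    [IsDomain R] [Algebra k R] : IsDomain (FieldA' k m ⊗[k] R) := by
  let P := MvPolynomial (Fin m) k
  let e : P ⊗[k] R ≃+* MvPolynomial (Fin m) R :=
    (Algebra.TensorProduct.comm k P R).toRingEquiv.trans
      (MvPolynomial.algebraTensorAlgEquiv k R).toRingEquiv
  have : IsDomain (P ⊗[k] R) := e.toMulEquiv.isDomain _
  have hle : Algebra.algebraMapSubmonoid (P ⊗[k] R) (nonZeroDivisors P) ≤
      nonZeroDivisors (P ⊗[k] R) := by
    rintro _ ⟨a, ha, rfl⟩
    refine mem_nonZeroDivisors_of_ne_zero ?_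
    rw [Ne, FaithfulSMul.algebraMap_eq_zero_iff]
    exact nonZeroDivisors.ne_zero ha
  let _ : Algebra (P ⊗[k] R) (FieldA' k m ⊗[k] R) := (Algebra.TensorProduct.map
    (IsScalarTower.toAlgHom k P (FieldA' k m)) (AlgHom.id k R)).toRingHom.toAlgebra
  have : IsScalarTower P (P ⊗[k] R) (FieldA' k m ⊗[k] R) :=
    IsScalarTower.of_algebraMap_eq (R := P) (S := P ⊗[k] R) (A := FieldA' k m ⊗[k] R) fun _ => rfl
  have : IsLocalization (Algebra.algebraMapSubmonoid (P ⊗[k] R) (nonZeroDivisors P))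
      (FieldA' k m ⊗[k] R) := by
    refine IsLocalization.tensorProduct_tensorProduct k R (nonZeroDivisors P) (FieldA' k m)
      (RingHom.ext fun r => ?_)
    change algebraMap P (FieldA' k m) 1 ⊗ₜ r = (1 : FieldA' k m) ⊗ₜ r
    rw [map_one]
  exact IsLocalization.isDomain_of_le_nonZeroDivisors (R := P ⊗[k] R) (FieldA' k m ⊗[k] R) hle

end IntegralityCriterion

/-! ### Centers of valuations, and finiteness of Ψ -/

namespace Curve

variable {k : Type u} [Field k] (C : Curve k)

theorem fromSpecStalk_hom : C.scheme.fromSpecStalk (genericPoint C.scheme) ≫ C.hom =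
    Spec.map (CommRingCat.ofHom (algebraMap k C.FunctionField)) := by
  have h1 : C.hom = C.scheme.toSpecΓ ≫ Spec.map (CommRingCat.ofHom (C.constants ⊤)) := by
    have h2 : CommRingCat.ofHom (C.constants ⊤) = (Scheme.ΓSpecIso (.of k)).inv ≫ C.hom.appTop := by
      rw [Scheme.Hom.appTop, Scheme.Hom.app_eq_appLE]
      rfl
    rw [h2, Spec.map_comp, ← Scheme.toSpecΓ_naturality_assoc, ← SpecMap_ΓSpecIso_hom,
      ← Spec.map_comp, Iso.inv_hom_id, Spec.map_id, Category.comp_id]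
  rw [h1, Scheme.fromSpecStalk_toSpecΓ_assoc, ← Spec.map_comp]
  rfl

/-- Every valuation ring of the function field containing the constants has a center. -/
theorem exists_center (V : ValuationSubring C.FunctionField)
    (hV : ∀ c : k, algebraMap k C.FunctionField c ∈ V) :
    ∃ x : C.scheme, ∀ a : C.scheme.presheaf.stalk x, algebraMap _ C.FunctionField a ∈ V ∧
      (a ∈ IsLocalRing.maximalIdeal _ → algebraMap _ C.FunctionField a ≠ 0 →
        (algebraMap _ C.FunctionField a)⁻¹ ∉ V) := by
  let j : k →+* V := (algebraMap k C.FunctionField).codRestrict V.toSubring hV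
  have hsq : CommSq (C.scheme.fromSpecStalk (genericPoint C.scheme))
      (Spec.map (CommRingCat.ofHom (algebraMap V C.FunctionField))) C.hom
      (Spec.map (CommRingCat.ofHom j)) := by
    refine ⟨C.fromSpecStalk_hom.trans ?_⟩
    exact Spec.map_comp (CommRingCat.ofHom j) (CommRingCat.ofHom (algebraMap V C.FunctionField))
  have hex : ValuativeCriterion.Existence C.hom := by
    have : UniversallyClosed C.hom := inferInstance
    rw [UniversallyClosed.eq_valuativeCriterion] at this
    exact this.1
  -- Properness supplies a lift `Spec V → C`; the center is the image of the closed point.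
  obtain ⟨l, hl, -⟩ := (hex ⟨V, C.FunctionField, _, _, hsq⟩).exists_lift
  dsimp only at hl
  let x := l (IsLocalRing.closedPoint V)
  let θ : C.scheme.presheaf.stalk x ⟶ .of V := Scheme.stalkClosedPointTo l
  have hθ : θ ≫ CommRingCat.ofHom (algebraMap V C.FunctionField) =
      C.scheme.presheaf.stalkSpecializes (genericPoint_specializes x) := by
    apply Spec.map_injective
    rw [← cancel_mono (C.scheme.fromSpecStalk x), Spec.map_comp, Category.assoc,
      Scheme.SpecMap_stalkSpecializes_fromSpecStalk]
    refine Eq.trans ?_ hl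
    congr 1
    exact Scheme.Spec_stalkClosedPointTo_fromSpecStalk l
  have hθ' : ∀ a, algebraMap _ C.FunctionField a = (θ a : C.FunctionField) :=
    fun a => congr($hθ.symm a)
  refine ⟨x, fun a => ⟨?_, fun ha ha0 hinv => ?_⟩⟩
  · rw [hθ']
    exact (θ a).2
  · rw [hθ'] at ha0 hinv
    -- The map from the stalk to `V` is local, so a nonunit cannot acquire an inverse in `V`.
    have hu : IsUnit (θ a) := IsUnit.of_mul_eq_one ⟨_, hinv⟩ (Subtype.ext (mul_inv_cancel₀ ha0))
    have hloc : IsLocalHom θ.hom := Scheme.isLocalHom_stalkClosedPointTo l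
    exact ha (isUnit_of_map_unit θ.hom a hu)

variable {C} {E : C.Divisor}

theorem ν_add_of_lt {p : C.ClosedPoint} {f g : C.FunctionField} (hg : g ≠ 0) (hf : f ≠ 0)
    (h : C.ν p f < C.ν p g) : f + g ≠ 0 ∧ C.ν p (f + g) = C.ν p f := by
  have hneg : C.ν p (-g) = C.ν p g := by
    have h1 : C.ν p (-1) = 0 := by
      have := ν_mul (p := p) (neg_ne_zero.mpr (one_ne_zero (α := C.FunctionField)))
        (neg_ne_zero.mpr (one_ne_zero (α := C.FunctionField)))
      rw [neg_one_mul, neg_neg, ν_one] at this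
      linarith
    rw [← neg_one_mul, ν_mul (neg_ne_zero.mpr one_ne_zero) hg, h1, zero_add]
  have h0 : f + g ≠ 0 := by
    intro h0
    rw [eq_neg_of_add_eq_zero_left h0, hneg] at h
    exact h.false
  refine ⟨h0, ?_⟩
  have h1 := min_ν_le_ν_add (p := p) h0
  have h2 := min_ν_le_ν_add (p := p) (f := f + g) (g := -g) (by simpa using hf)
  rw [add_neg_cancel_right, hneg] at h2
  rw [min_eq_left h.le] at h1
  rcases min_le_iff.mp h2 with h3 | h3
  · exact le_antisymm h3 h1
  · exact absurd h3 (not_le.mpr h)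

theorem exists_mem_maximalIdeal_of_ν_pos {p : C.ClosedPoint} {f : C.FunctionField}
    (h : f = 0 ∨ 0 < C.ν p f) :
    ∃ a ∈ IsLocalRing.maximalIdeal (C.scheme.presheaf.stalk p.1),
      algebraMap _ C.FunctionField a = f := by
  rcases eq_or_ne f 0 with rfl | hf
  · exact ⟨0, zero_mem _, map_zero _⟩
  have h := h.resolve_left hf
  obtain ⟨a, rfl⟩ := exists_algebraMap_eq_of_ν_nonneg h.le
  refine ⟨a, ?_, rfl⟩
  rw [IsLocalRing.mem_maximalIdeal, mem_nonunits_iff, isUnit_iff_ν_eq_zero (by rintro rfl; simp at hf)]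
  exact h.ne'

theorem ν_add_lt {p : C.ClosedPoint} {f g : C.FunctionField} {n : ℤ} (hn : 0 ≤ n)
    (h : C.ν p f ≠ C.ν p g) (hf : n < -C.ν p f) (hg : n < -C.ν p g) :
    f + g ≠ 0 ∧ n < -C.ν p (f + g) := by
  -- `ν` takes the default value 0 at 0, so a pole of order greater than `n ≥ 0` excludes the zero
  -- function.
  have h0 : ∀ f : C.FunctionField, n < -C.ν p f → f ≠ 0 := by
    rintro _ h rfl
    rw [ν, Scheme.ord_zero] at h
    simp at h
    linarith
  rcases h.lt_or_gt with h | h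
  · obtain ⟨h1, h2⟩ := ν_add_of_lt (h0 g hg) (h0 f hf) h
    exact ⟨h1, h2 ▸ hf⟩
  · obtain ⟨h1, h2⟩ := ν_add_of_lt (h0 f hf) (h0 g hg) h
    rw [add_comm]
    exact ⟨h1, h2 ▸ hg⟩

/-- A valuation ring containing k(A') and Ψ cannot be centered on the support of `E`: there σ + f₀
has a larger pole than every gⱼ, so Ψ itself would have a pole. Centered elsewhere, it contains `R`.
-/
theorem IsVeryAmple.isIntegral_of_psi_mem_range (hE : C.IsVeryAmple E) (hE0 : 0 ≤ E)
    {f₀ σ : C.RegularFunctions E}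
    (hf₀ : ∀ p ∈ E.support, E p < -C.ν p (C.toRational E f₀))
    (hσ : ∀ p ∈ E.support, C.ν p (C.toRational E σ) ≠ C.ν p (C.toRational E f₀) ∧
      E p < -C.ν p (C.toRational E σ))
    {m : ℕ} {g : Fin m → C.RegularFunctions E} (hg : ∀ j, C.toRational E (g j) ∈ C.H0 E)
    {A : Type u} [CommRing A] [Algebra A (FieldA' k m ⊗[k] C.RegularFunctions E)]
    (hF : ∀ c : FieldA' k m, c ⊗ₜ 1 ∈ Set.range
      (algebraMap A (FieldA' k m ⊗[k] C.RegularFunctions E)))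
    (hΨ : psi k σ f₀ g ∈ Set.range (algebraMap A (FieldA' k m ⊗[k] C.RegularFunctions E))) :
    Algebra.IsIntegral A (FieldA' k m ⊗[k] C.RegularFunctions E) := by
  let R := C.RegularFunctions E
  let S := FieldA' k m ⊗[k] R
  let F := FractionRing S
  have : IsFractionRing R C.FunctionField :=
    functionField_isFractionRing_of_isAffineOpen _ _ (hE.isAffineOpen_compl_and_range hE0).1
  let τ : R →+* F := (algebraMap S F).comp Algebra.TensorProduct.includeRight.toRingHom
  have hτ : Function.Injective τ := (IsFractionRing.injective S F).comp
    (Algebra.TensorProduct.includeRight_injective (FaithfulSMul.algebraMap_injective k _))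
  let ι : C.FunctionField →+* F := IsFractionRing.lift hτ
  have hι : ∀ r, ι (C.toRational E r) = algebraMap S F (1 ⊗ₜ r) :=
    fun r => IsFractionRing.lift_algebraMap hτ r
  have key : ∀ r : R, _root_.IsIntegral A (1 ⊗ₜ r : S) := by
    intro r
    refine isIntegral_of_forall_valuationSubring (F := F) fun V hV => ?_
    have hVF : ∀ c : FieldA' k m, algebraMap S F (c ⊗ₜ 1) ∈ V := fun c => by
      obtain ⟨a, ha⟩ := hF c
      exact ha ▸ hV a
    have hVΨ : algebraMap S F (psi k σ f₀ g) ∈ V := by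
      obtain ⟨a, ha⟩ := hΨ
      exact ha ▸ hV a
    obtain ⟨x, hx⟩ := C.exists_center (V.comap ι) fun c => by
      rw [ValuationSubring.mem_comap,
        IsScalarTower.algebraMap_apply k (C.RegularFunctions E) C.FunctionField]
      have h1 : (1 ⊗ₜ algebraMap k R c : S) = (c • 1) ⊗ₜ 1 := by
        rw [Algebra.algebraMap_eq_smul_one, TensorProduct.smul_tmul]
      have h2 := hι (algebraMap k R c)
      rw [h1] at h2
      exact h2.symm ▸ hVF _
    rw [← hι]
    by_cases hxE : x ∈ C.compl E
    · have h1 := (hx (C.scheme.presheaf.germ (C.compl E) x hxE r)).1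
      rw [Scheme.algebraMap_germ_eq_germToFunctionField] at h1
      exact h1
    exfalso
    simp only [mem_compl_iff, not_forall] at hxE
    obtain ⟨p, rfl, hpE⟩ := hxE
    have hp : p ∈ E.support := Finsupp.mem_support_iff.mpr hpE
    obtain ⟨hu0, hu⟩ := ν_add_lt (hE0 p) (hσ p hp).1 (hσ p hp).2 (hf₀ p hp)
    set u := C.toRational E σ + C.toRational E f₀ with hudef
    have hEp : 0 ≤ E p := hE0 p
    have hm : ∀ f : C.FunctionField, f = 0 ∨ 0 < C.ν p f → V.valuation (ι f) < 1 := by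
      intro f hf
      obtain ⟨a, ha, rfl⟩ := exists_mem_maximalIdeal_of_ν_pos hf
      by_contra! hlt
      have ha0 : ι (algebraMap _ C.FunctionField a) ≠ 0 := by
        intro h0
        rw [h0, map_zero] at hlt
        exact not_lt.mpr hlt zero_lt_one
      refine (hx a).2 ha (fun h0 => ha0 (by rw [h0, map_zero])) ?_
      rw [ValuationSubring.mem_comap, map_inv₀, ← V.valuation_le_one_iff, map_inv₀]
      exact inv_le_one_of_one_le₀ hlt
    have hz : V.valuation (ι u⁻¹) < 1 := hm _ (.inr (by rw [ν_inv hu0]; linarith))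
    have hzg : ∀ j, V.valuation (ι (u⁻¹ * C.toRational E (g j))) < 1 := by
      intro j
      refine hm _ ?_
      rcases hg j with h0 | h0
      · left
        rw [h0, mul_zero]
      · by_cases hgj : C.toRational E (g j) = 0
        · left
          rw [hgj, mul_zero]
        right
        rw [ν_mul (inv_ne_zero hu0) hgj, ν_inv hu0]
        linarith [h0 p]
    -- Divide Ψ by its dominant term `u`. The left side and the sum on the right both have valuation
    -- below 1, which would force the same for 1.
    have hone : ι u⁻¹ * algebraMap S F (psi k σ f₀ g) = 1 +
        ∑ j, algebraMap S F (varA' k j ⊗ₜ 1) * ι (u⁻¹ * C.toRational E (g j)) := by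
      have h1 : algebraMap S F (psi k σ f₀ g) = ι u +
          ∑ j, algebraMap S F (varA' k j ⊗ₜ 1) * ι (C.toRational E (g j)) := by
        have hu' : ι u = algebraMap S F (1 ⊗ₜ (σ + f₀)) := by
          rw [← hι, hudef]
          exact congrArg ι (map_add (algebraMap R C.FunctionField) σ f₀).symm
        rw [psi, map_add, hu', map_sum]
        congr 1
        refine Finset.sum_congr rfl fun j _ => ?_
        rw [hι, ← map_mul, Algebra.TensorProduct.tmul_mul_tmul, mul_one, one_mul]
      rw [h1, mul_add, ← map_mul, inv_mul_cancel₀ hu0, map_one, Finset.mul_sum]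
      congr 1
      refine Finset.sum_congr rfl fun j _ => ?_
      rw [map_mul]
      ring
    have h2 : V.valuation (ι u⁻¹ * algebraMap S F (psi k σ f₀ g)) < 1 := by
      rw [map_mul]
      exact (mul_le_of_le_one_right' ((V.valuation_le_one_iff _).mpr hVΨ)).trans_lt hz
    have h3 : V.valuation
        (∑ j, algebraMap S F (varA' k j ⊗ₜ 1) * ι (u⁻¹ * C.toRational E (g j))) < 1 := by
      refine V.valuation.map_sum_lt one_ne_zero fun j _ => ?_
      rw [map_mul]
      exact (mul_le_of_le_one_left' ((V.valuation_le_one_iff _).mpr (hVF _))).trans_lt (hzg j)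
    have h4 : V.valuation (1 : F) < 1 := by
      rw [← sub_eq_of_eq_add hone]
      exact V.valuation.map_sub_lt h2 h3
    rw [map_one] at h4
    exact h4.false
  refine ⟨fun s => ?_⟩
  induction s using TensorProduct.induction_on with
  | zero => exact isIntegral_zero
  | add x y hx hy => exact hx.add hy
  | tmul c r =>
    have h1 : _root_.IsIntegral A (c ⊗ₜ 1 : S) := by
      obtain ⟨a, ha⟩ := hF c
      exact ha ▸ isIntegral_algebraMap
    have := h1.mul (key r)
    rwa [Algebra.TensorProduct.tmul_mul_tmul, mul_one, one_mul] at this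

end Curve

/-! ### Ramification of the splitting field at a prime -/

/-- Each fibre of Ω over `F` is a line, and passing to differentials over `A` kills `da`. Where `da
≠ 0` nothing remains, so the support of the relative differentials has no point over `P`. -/
theorem exists_forall_smul_D_eq_zero {F A S : Type*} [Field F] [CommRing A] [Algebra F A]
    [CommRing S] [Algebra F S] [Algebra A S] [IsScalarTower F A S] [Module.Finite A S]
    (hS : ∀ x : PrimeSpectrum S, Module.finrank x.asIdeal.ResidueField
      (x.asIdeal.ResidueField ⊗[S] Ω[S⁄F]) = 1)
    (P : Ideal A) [P.IsPrime] (a : A)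
    (h : ∀ x : PrimeSpectrum S, x.asIdeal.comap (algebraMap A S) = P →
      ¬ DiffVanishesAt F (algebraMap A S a) x) :
    ∃ c ∉ P, ∀ s : S, c • KaehlerDifferential.D A S s = 0 := by
  by_contra! hc
  let J := Module.annihilator S Ω[S⁄A]
  have hJ : J.comap (algebraMap A S) ≤ P := by
    intro c hcJ
    by_contra hcP
    obtain ⟨s, hs⟩ := hc c hcP
    refine hs ?_
    rw [← algebraMap_smul S]
    exact Module.mem_annihilator.mp hcJ _
  -- If no annihilating element avoids `P`, lying over gives a point over `P` in the support of the
  -- relative differentials.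
  obtain ⟨Q, hJQ, hQ, hQP⟩ := Ideal.exists_ideal_over_prime_of_isIntegral P J hJ
  let x : PrimeSpectrum S := ⟨Q, hQ⟩
  have hx : x ∈ Module.support S Ω[S⁄A] := by
    rw [Module.mem_support_iff_of_finite]
    exact hJQ
  have hn := (Module.mem_support_iff_nontrivial_residueField_tensorProduct x).mp hx
  refine not_subsingleton_iff_nontrivial.mpr hn ?_
  let κ := x.asIdeal.ResidueField
  let θ : κ ⊗[S] Ω[S⁄F] →ₗ[κ] κ ⊗[S] Ω[S⁄A] :=
    (KaehlerDifferential.map F A S S).baseChange κ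
  have hθ : Function.Surjective θ :=
    LinearMap.lTensor_surjective κ (KaehlerDifferential.map_surjective F A S)
  let v : κ ⊗[S] Ω[S⁄F] := 1 ⊗ₜ KaehlerDifferential.D F S (algebraMap A S a)
  have hv : v ≠ 0 := h x hQP
  have hθv : θ v = 0 := by
    change 1 ⊗ₜ KaehlerDifferential.map F A S S (KaehlerDifferential.D F S _) = 0
    rw [KaehlerDifferential.map_D, Algebra.algebraMap_self_apply, Derivation.map_algebraMap,
      TensorProduct.tmul_zero]
  refine subsingleton_of_forall_eq 0 fun w => ?_
  obtain ⟨w, rfl⟩ := hθ w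
  obtain ⟨c, rfl⟩ := (finrank_eq_one_iff_of_nonzero' v hv).mp (hS x) w
  rw [map_smul, hθv, smul_zero]

/-- Each embedding of a residue field at a prime containing `I` restricts to an `A`-homomorphism
from `S`, because `S → T` is `A`-linear modulo `I`. Conversely `S` generates `T` over `K`, and the
residue field consists of quotients of images of `T`. -/
theorem adjoin_iUnion_range_splittingField {A K S T : Type*} [CommRing A] [Field K] [Algebra A K]
    [CommRing S] [Algebra A S] [CommRing T] [Algebra K T] (ι : S →+* T) (I : Ideal T)
    (hι : ∀ a, ι (algebraMap A S a) - algebraMap K T (algebraMap A K a) ∈ I)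
    (hT : Algebra.adjoin K (Set.range ι) = ⊤) :
    IntermediateField.adjoin K (⋃ f : S →ₐ[A] splittingField K I, Set.range f) = ⊤ := by
  apply IntermediateField.lift_injective
  rw [IntermediateField.lift_top, IntermediateField.lift_adjoin]
  refine le_antisymm ?_ ?_
  · rw [IntermediateField.adjoin_le_iff]
    rintro _ ⟨z, -, rfl⟩
    exact z.2
  conv_lhs => rw [splittingField]
  refine iSup_le fun Q => iSup_le fun j => ?_
  set M := IntermediateField.adjoin K
    (Subtype.val '' ⋃ f : S →ₐ[A] splittingField K I, Set.range f)
  let κ := Q.1.asIdeal.ResidueField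
  let φ : T →ₐ[K] AlgebraicClosure K := j.comp (IsScalarTower.toAlgHom K T κ)
  have hφL : ∀ t, φ t ∈ splittingField K I := fun t =>
    (le_iSup_of_le Q (le_iSup (fun f : κ →ₐ[K] AlgebraicClosure K => f.fieldRange) j) :
      j.fieldRange ≤ splittingField K I) ⟨_, rfl⟩
  have hφI : ∀ t ∈ I, φ t = 0 := by
    intro t ht
    change j (algebraMap T κ t) = 0
    rw [Ideal.algebraMap_residueField_eq_zero.mpr (Q.2 ht), map_zero]
  let f : S →ₐ[A] splittingField K I :=
    { (φ.toRingHom.comp ι).codRestrict (splittingField K I).toSubfield fun s => hφL _ with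
      commutes' := fun a => Subtype.ext <| by
        change φ (ι (algebraMap A S a)) = algebraMap A (AlgebraicClosure K) a
        rw [← sub_eq_zero, IsScalarTower.algebraMap_apply A K (AlgebraicClosure K),
          ← φ.commutes, ← map_sub]
        exact hφI _ (hι a) }
  have hφM : ∀ t, φ t ∈ M := by
    have h1 : Algebra.adjoin K (Set.range ι) ≤ M.toSubalgebra.comap φ := by
      rw [Algebra.adjoin_le_iff]
      rintro _ ⟨s, rfl⟩
      exact IntermediateField.subset_adjoin _ _ ⟨f s, Set.mem_iUnion.mpr ⟨f, s, rfl⟩, rfl⟩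
    exact fun t => h1 (hT ▸ Algebra.mem_top)
  rintro _ ⟨z, rfl⟩
  obtain ⟨a, b, hb, rfl⟩ := IsFractionRing.div_surjective (A := T ⧸ Q.1.asIdeal) (z : κ)
  obtain ⟨a, rfl⟩ := Ideal.Quotient.mk_surjective a
  obtain ⟨b, rfl⟩ := Ideal.Quotient.mk_surjective b
  change j _ ∈ M
  rw [map_div₀]
  exact div_mem (hφM a) (hφM b)

theorem exists_mem_discriminantIdeal_splittingField_notMem {A K S T : Type*} [CommRing A]
    [IsDomain A] [IsPrincipalIdealRing A] [Field K] [Algebra A K] [IsFractionRing A K] [CommRing S]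
    [Algebra A S] [Module.Finite A S] [CommRing T] [Algebra K T] (P : Ideal A) [P.IsPrime]
    (hP : ∃ c ∉ P, ∀ s : S, c • KaehlerDifferential.D A S s = 0) (ι : S →+* T) (I : Ideal T)
    (hι : ∀ a, ι (algebraMap A S a) - algebraMap K T (algebraMap A K a) ∈ I)
    (hT : Algebra.adjoin K (Set.range ι) = ⊤) :
    ∃ d ∈ discriminantIdeal A K (splittingField K I), d ∉ P :=
  exists_mem_discriminantIdeal_notMem P hP (adjoin_iUnion_range_splittingField ι I hι hT)

theorem finrank_tensorProduct_kaehlerDifferential_baseChange {k F R κ : Type u} [Field k] [Field F]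
    [Algebra k F] [CommRing R] [Algebra k R] [Field κ] [Algebra (F ⊗[k] R) κ]
    (h : RingHom.Locally (RingHom.IsStandardSmoothOfRelativeDimension 1) (algebraMap k R)) :
    Module.finrank κ (κ ⊗[F ⊗[k] R] Ω[(F ⊗[k] R)⁄F]) = 1 := by
  refine finrank_tensorProduct_kaehlerDifferential_of_locally ?_ κ
  have h1 := RingHom.locally_isStableUnderBaseChange
    (RingHom.isStandardSmoothOfRelativeDimension_respectsIso (n := 1))
    (RingHom.isStandardSmoothOfRelativeDimension_isStableUnderBaseChange (n := 1))
  let _ := Algebra.TensorProduct.rightAlgebra (R := k) (A := F) (B := R)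
  exact h1 k R F (F ⊗[k] R) h

/-! ### The discriminant of Ψ + A₀ and critical values -/

section Generic

open Polynomial

variable {k : Type u} [Field k] {m : ℕ} {R : Type u} [CommRing R] [Algebra k R]

variable (k m R) in
/-- The base change `k(A') ⊗ R → k(A) ⊗ R`. -/
def toFieldA : FieldA' k m ⊗[k] R →+* FieldA k m ⊗[k] R :=
  (Algebra.TensorProduct.map ((Algebra.ofId (FieldA' k m) (FieldA k m)).restrictScalars k)
    (AlgHom.id k R)).toRingHom

theorem toFieldA_tmul (c : FieldA' k m) (r : R) :
    toFieldA k m R (c ⊗ₜ r) = algebraMap (FieldA' k m) (FieldA k m) c ⊗ₜ r := rfl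

theorem adjoin_range_toFieldA :
    Algebra.adjoin (FieldA k m) (Set.range (toFieldA k m R)) = ⊤ := by
  refine top_le_iff.mp fun t _ => ?_
  induction t using TensorProduct.induction_on with
  | zero => exact zero_mem _
  | add x y hx hy => exact add_mem (hx trivial) (hy trivial)
  | tmul c r =>
    have h1 : (c ⊗ₜ r : FieldA k m ⊗[k] R) = c • toFieldA k m R (1 ⊗ₜ r) := by
      rw [toFieldA_tmul, map_one, TensorProduct.smul_tmul', smul_eq_mul, mul_one]
    rw [h1]
    exact Subalgebra.smul_mem _ (Algebra.subset_adjoin (Set.mem_range_self _)) c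

theorem toFieldA_psi (σ f₀ : R) (g : Fin m → R) :
    toFieldA k m R (psi k σ f₀ g) = linearAtGeneric k σ f₀ g - varA₀ k m ⊗ₜ 1 := by
  rw [psi, linearAtGeneric, RingHom.map_add, map_sum (toFieldA k m R), toFieldA_tmul, map_one]
  simp only [toFieldA_tmul]
  abel

/-- Modulo Ψ + A₀ the variable A₀ equals -Ψ; this is why k(A')[A₀] acts on k(A') ⊗ R through -Ψ. -/
theorem toFieldA_aeval_neg_psi_sub_mem (σ f₀ : R) (g : Fin m → R) (a : (FieldA' k m)[X]) :
    toFieldA k m R (aeval (-psi k σ f₀ g) a) -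
      algebraMap (FieldA k m) (FieldA k m ⊗[k] R) (algebraMap (FieldA' k m)[X] (FieldA k m) a) ∈
      Ideal.span {linearAtGeneric k σ f₀ g} := by
  set I := Ideal.span {linearAtGeneric k σ f₀ g}
  rw [← Ideal.Quotient.eq]
  have : ((Ideal.Quotient.mk I).comp (toFieldA k m R)).comp
      (aeval (-psi k σ f₀ g) : (FieldA' k m)[X] →ₐ[FieldA' k m] FieldA' k m ⊗[k] R).toRingHom =
      ((Ideal.Quotient.mk I).comp (algebraMap (FieldA k m) (FieldA k m ⊗[k] R))).comp
        (algebraMap (FieldA' k m)[X] (FieldA k m)) := by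
    refine Polynomial.ringHom_ext (fun c => ?_) ?_
    · change Ideal.Quotient.mk I (toFieldA k m R (aeval (-psi k σ f₀ g) (C c))) = _
      rw [aeval_C, Algebra.TensorProduct.algebraMap_apply, toFieldA_tmul]
      rfl
    · change Ideal.Quotient.mk I (toFieldA k m R (aeval (-psi k σ f₀ g) X)) =
        Ideal.Quotient.mk I (varA₀ k m ⊗ₜ 1)
      rw [aeval_X, map_neg, toFieldA_psi, Ideal.Quotient.eq, neg_sub, sub_sub_cancel_left,
        neg_mem_iff]
      exact Ideal.mem_span_singleton_self _
  exact congr($this a)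

theorem exists_diffVanishesAt_of_discL_le
    (hR : RingHom.Locally (RingHom.IsStandardSmoothOfRelativeDimension 1) (algebraMap k R))
    [Algebra.FiniteType k R] (σ f₀ : R) (g : Fin m → R)
    (hint : ((aeval (-psi k σ f₀ g) : (FieldA' k m)[X] →ₐ[FieldA' k m] FieldA' k m ⊗[k] R) :
      (FieldA' k m)[X] →+* FieldA' k m ⊗[k] R).IsIntegral)
    (P : PrimeSpectrum (FieldA' k m)[X]) (hP : discL k σ f₀ g ≤ P.asIdeal) :
    ∃ x, DiffVanishesAt (FieldA' k m) (psi k σ f₀ g) x ∧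
      valueAt (FieldA' k m) (-psi k σ f₀ g) x = P := by
  by_contra! hx
  let A := (FieldA' k m)[X]
  let S := FieldA' k m ⊗[k] R
  let K := FieldA k m
  let T := K ⊗[k] R
  let α : A →ₐ[FieldA' k m] S := aeval (-psi k σ f₀ g)
  let _ : Algebra A S := α.toRingHom.toAlgebra
  have : IsScalarTower (FieldA' k m) A S := .of_algebraMap_eq fun c => (α.commutes c).symm
  have : Algebra.IsIntegral A S := ⟨hint⟩
  have : Algebra.FiniteType A S := .of_restrictScalars_finiteType (FieldA' k m) A S
  have : Module.Finite A S := Algebra.IsIntegral.finite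
  have hαX : algebraMap A S X = -psi k σ f₀ g := aeval_X _
  -- The element `-X` is used since it maps to Ψ itself, whose differential is the one in question.
  obtain ⟨c, hcP, hc⟩ := exists_forall_smul_D_eq_zero
    (fun x => finrank_tensorProduct_kaehlerDifferential_baseChange hR) P.asIdeal (-X : A)
    fun x hxP hdx => by
      rw [map_neg (algebraMap A S), hαX, neg_neg] at hdx
      exact hx x hdx (PrimeSpectrum.ext hxP)
  let ι : S →+* T := toFieldA k m R
  let I : Ideal T := Ideal.span {linearAtGeneric k σ f₀ g}
  have hιI : ∀ a, ι (algebraMap A S a) - algebraMap K T (algebraMap A K a) ∈ I :=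
    toFieldA_aeval_neg_psi_sub_mem σ f₀ g
  have hT : Algebra.adjoin K (Set.range ι) = ⊤ := adjoin_range_toFieldA
  obtain ⟨d, hd, hdP⟩ :=
    exists_mem_discriminantIdeal_splittingField_notMem P.asIdeal ⟨c, hcP, hc⟩ ι I hιI hT
  exact hdP (hP hd)

theorem valueAt_eq_of_valueAt_neg_eq {F S : Type*} [Field F] [CommRing S] [Algebra F S] {Ψ₁ Ψ₂ : S}
    {x y : PrimeSpectrum S} (h : valueAt F (-Ψ₁) x = valueAt F (-Ψ₂) y) :
    valueAt F Ψ₁ x = valueAt F Ψ₂ y := by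
  have key : ∀ (Ψ : S) (x : PrimeSpectrum S), valueAt F Ψ x =
      PrimeSpectrum.comap (aeval (-X) : F[X] →ₐ[F] F[X]).toRingHom (valueAt F (-Ψ) x) := by
    intro Ψ x
    have h1 : (aeval Ψ : F[X] →ₐ[F] S) = (aeval (-Ψ)).comp (aeval (-X)) := by
      ext
      simp
    rw [valueAt, valueAt, h1]
    rfl
  rw [key Ψ₁, key Ψ₂, h]

end Generic

namespace Curve

variable {k : Type u} [Field k] {C : Curve k} {E : C.Divisor}

theorem IsVeryAmple.finiteType (hE : C.IsVeryAmple E) (hE0 : 0 ≤ E) :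
    Algebra.FiniteType k (C.RegularFunctions E) := by
  have h := (hE.isAffineOpen_compl_and_range hE0).2
  obtain ⟨n, s, -, hs, -⟩ := hE
  refine ⟨Subalgebra.fg_of_fg_map _ (IsScalarTower.toAlgHom k (C.RegularFunctions E)
    C.FunctionField) (toRational_injective E) ?_⟩
  rw [Algebra.map_top, h, ← hs, Algebra.adjoin_span]
  exact Subalgebra.fg_def.mpr ⟨_, Set.finite_range s, rfl⟩

theorem IsVeryAmple.isIntegral_aeval_neg_psi (hE : C.IsVeryAmple E) (hE0 : 0 ≤ E)
    {f₀ σ : C.RegularFunctions E}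
    (hf₀ : ∀ p ∈ E.support, E p < -C.ν p (C.toRational E f₀))
    (hσ : ∀ p ∈ E.support, C.ν p (C.toRational E σ) ≠ C.ν p (C.toRational E f₀) ∧
      E p < -C.ν p (C.toRational E σ))
    {m : ℕ} {g : Fin m → C.RegularFunctions E} (hg : ∀ j, C.toRational E (g j) ∈ C.H0 E) :
    ((Polynomial.aeval (-psi k σ f₀ g) : Polynomial (FieldA' k m) →ₐ[FieldA' k m]
      FieldA' k m ⊗[k] C.RegularFunctions E) :
      Polynomial (FieldA' k m) →+* FieldA' k m ⊗[k] C.RegularFunctions E).IsIntegral := by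
  let α : Polynomial (FieldA' k m) →ₐ[FieldA' k m] FieldA' k m ⊗[k] C.RegularFunctions E :=
    Polynomial.aeval (-psi k σ f₀ g)
  let _ : Algebra (Polynomial (FieldA' k m)) (FieldA' k m ⊗[k] C.RegularFunctions E) :=
    α.toRingHom.toAlgebra
  have := hE.isIntegral_of_psi_mem_range hE0 hf₀ hσ hg (A := Polynomial (FieldA' k m))
    (fun c => ⟨_, α.commutes c⟩)
    ⟨-Polynomial.X, (map_neg α _).trans ((congrArg _ (Polynomial.aeval_X _)).trans (neg_neg _))⟩
  exact this.isIntegral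

end Curve

end ShortInterval

end

theorem mainTheorem6 {k : Type*} [Field k] [Finite k] (hchar : ringChar k ≠ 2)
    (C : Curve k) (E : C.Divisor) (hE : 0 ≤ E) (hEample : C.IsVeryAmple E)
    (hE₀ : ∃ E₀ : C.Divisor, 0 ≤ E₀ ∧ C.IsVeryAmple E₀ ∧ 3 • E₀ ≤ E)
    (f₀ : C.RegularFunctions E)
    (hf₀ : ∀ p ∈ E.support, E p < -C.ν p (C.toRational E f₀))
    (σ₁ σ₂ : C.RegularFunctions E) (hσ : σ₁ ≠ σ₂)
    (hσ₁ : ∀ p ∈ E.support, C.ν p (C.toRational E σ₁) ≠ C.ν p (C.toRational E f₀) ∧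
      E p < -C.ν p (C.toRational E σ₁))
    (hσ₂ : ∀ p ∈ E.support, C.ν p (C.toRational E σ₂) ≠ C.ν p (C.toRational E f₀) ∧
      E p < -C.ν p (C.toRational E σ₂))
    (m : ℕ) (g : Fin m → C.RegularFunctions E)
    (hg_indep : LinearIndependent k (Fin.cons 1 (fun j => C.toRational E (g j)) :
      Fin (m + 1) → C.FunctionField))
    (hg_span : (Submodule.span k (Set.range (Fin.cons 1 (fun j => C.toRational E (g j)) :
      Fin (m + 1) → C.FunctionField)) : Set C.FunctionField) = C.H0 E) :
    (¬ ∃ x y : PrimeSpectrum (FieldA' k m ⊗[k] C.RegularFunctions E),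
      DiffVanishesAt (FieldA' k m) (psi k σ₁ f₀ g) x ∧
      DiffVanishesAt (FieldA' k m) (psi k σ₂ f₀ g) y ∧
      valueAt (FieldA' k m) (psi k σ₁ f₀ g) x =
        valueAt (FieldA' k m) (psi k σ₂ f₀ g) y) ∧
    Disjoint
      (branchLocus (FieldA' k m) (psi k σ₁ f₀ g))
      (branchLocus (FieldA' k m) (psi k σ₂ f₀ g)) ∧
    ∀ D₁ D₂ : Polynomial (FieldA' k m),
      discL k σ₁ f₀ g = Ideal.span {D₁} →
      discL k σ₂ f₀ g = Ideal.span {D₂} → IsCoprime D₁ D₂ := by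
  obtain ⟨E₀, hE₀0, hE₀, h⟩ := hE₀
  have h1 := Curve.not_exists_common_critical_value hE hEample hE₀0 hE₀ h f₀ σ₁ σ₂ hσ g hg_span
  refine ⟨h1, ?_, ?_⟩
  · rw [Set.disjoint_left]
    rintro _ ⟨x, hx, rfl⟩ ⟨y, hy, hxy⟩
    exact h1 ⟨x, y, hx, hy, hxy.symm⟩
  · intro D₁ D₂ hD₁ hD₂
    have hR := hEample.constants_locally hE
    have := hEample.finiteType hE
    have hg : ∀ j, C.toRational E (g j) ∈ C.H0 E := fun j =>
      hg_span ▸ Submodule.subset_span ⟨j.succ, rfl⟩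
    rw [← Ideal.isCoprime_span_singleton_iff, Ideal.isCoprime_iff_sup_eq, ← hD₁, ← hD₂]
    by_contra hne
    -- `P` contains both discriminant ideals, so it is a value of -Ψ₁ and of -Ψ₂ at critical points;
    -- the substitution A₀ ↦ -A₀ turns this into a common critical value of Ψ₁ and Ψ₂.
    obtain ⟨P, hP, hle⟩ := Ideal.exists_le_maximal _ hne
    obtain ⟨x, hx, hxP⟩ := exists_diffVanishesAt_of_discL_le hR σ₁ f₀ g
      (hEample.isIntegral_aeval_neg_psi hE hf₀ hσ₁ hg) ⟨P, hP.isPrime⟩ (le_sup_left.trans hle)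
    obtain ⟨y, hy, hyP⟩ := exists_diffVanishesAt_of_discL_le hR σ₂ f₀ g
      (hEample.isIntegral_aeval_neg_psi hE hf₀ hσ₂ hg) ⟨P, hP.isPrime⟩ (le_sup_right.trans hle)
    exact h1 ⟨x, y, hx, hy, valueAt_eq_of_valueAt_neg_eq (hxP.trans hyP.symm)⟩
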